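/- Let $n\ge 1$ and $\alpha\in(1/2,1)$. For $u:\mathbb R\to\mathbb R^n$ let $${}_{-\infty}D_t^{\alpha}u(t)=\frac{1}{\Gamma(1-\alpha)}\frac{d}{dt}\int_{-\infty}^{t}(t-\xi)^{-\alpha}u(\xi)\,d\xi$$ be the left Liouville–Weyl fractional derivative, let ${}_tD_\infty^\alpha$ be the right one, and let $H^{\alpha}(\mathbb R,\mathbb R^n)$ be the completion of $C_0^\infty(\mathbb R,\mathbb R^n)$ for the norm $\left(\|u\|_{L^2}^2+\|{}_{-\infty}D_t^{\alpha}u\|_{L^2}^2\right)^{1/2}$, with ${}_{-\infty}D_t^{\alpha}$ extended to it by continuity into $L^2$. Assume: (L) $L:\mathbb R\to\mathbb R^{n\times n}$ is continuous, $L(t)$ is symmetric and positive definite for every $t$, and there is a continuous $l:\mathbb R\to(0,\infty)$ with $l(t)\to+\infty$ as $|t|\to\infty$ and $(L(t)x,x)\ge l(t)|x|^2$ for all $t\in\mathbb R$, $x\in\mathbb R^n$. (W$_1$) $W\in C^1(\mathbb R\times\mathbb R^n,\mathbb R)$ and there is $\mu>2$ with $0<\mu W(t,x)\le (x,\nabla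 W(t,x))$ for all $t\in\mathbb R$ and $x\in\mathbb R^n\setminus\{0\}$, where $\nabla$ is the gradient in $x$. (W$_2$) $|\nabla W(t,x)|=o(|x|)$ as $x\to0$, uniformly in $t\in\mathbb R$. Let $X^\alpha=\{u\in H^\alpha(\mathbb R,\mathbb R^n):\int_{\mathbb R}|{}_{-\infty}D_t^{\alpha}u|^2+(L(t)u,u)\,dt<\infty\}$ with the inner product $\langle u,v\rangle=\int_{\mathbb R}({}_{-\infty}D_t^{\alpha}u,{}_{-\infty}D_t^{\alpha}v)+(L(t)u,v)\,dt$. Then $W(\cdot,u(\cdot))$ is integrable for every $u\in X^\alpha$, the functional $$I(u)=\frac12\int_{\mathbb R}\left[|{}_{-\infty}D_t^{\alpha}u|^2+(L(t)u,u)\right]dt-\int_{\mathbb R}W(t,u(t))\,dt$$ is of class $C^1$ on $X^\alpha$, and the fractional Hamiltonian system $${}_tD_\infty^\alpha({}_{-\infty}D_t^\alpha u)+L(t)u=\nabla W(t,u)$$ has a nontrivial weak solution: there is $u\in X^\alpha$, $u\ne0$, such that for all $v\in X^\alpha$ (all integrals being convergent) $$\int_{\mathbb R}\left[({}_{-\infty}D_t^{\alpha}u,{}_{-\infty}D_t^{\alpha}v)+(L(t)u,v)\right]dt=\int_{\mathbb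 R}(\nabla W(t,u),v)\,dt .$$ Moreover $u$ can be taken to be a mountain-pass critical point of $I$: $I'(u)=0$, $I(0)=0$, and there are $\rho,\beta>0$ and $e\in X^\alpha$ with $I\ge\beta$ on $\{\|w\|=\rho\}$, $\|e\|>\rho$, $I(e)\le0$, and $$I(u)=\inf_{\gamma}\max_{s\in[0,1]}I(\gamma(s))\ge\beta,$$ the infimum being over all continuous $\gamma:[0,1]\to X^\alpha$ with $\gamma(0)=0$ and $\gamma(1)=e$. -/

import Mathlib

open MeasureTheory Filter Topology
open scoped ContDiff

noncomputable section

namespace FracHam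

/-- The Euclidean space `ℝⁿ`. -/
abbrev Vec (n : ℕ) : Type := EuclideanSpace ℝ (Fin n)

/-- `L²(ℝ, ℝⁿ)`. -/
abbrev L2 (n : ℕ) : Type := Lp (Vec n) 2 (volume : Measure ℝ)

/-- The product `M x` of a matrix and a vector of `ℝⁿ`. -/
def matVec {n : ℕ} (M : Matrix (Fin n) (Fin n) ℝ) (x : Vec n) : Vec n :=
  WithLp.toLp 2 (M.mulVec x.ofLp)

/-- The left Liouville–Weyl fractional integral of order `β`,
`(1 / Γ(β)) ∫_{-∞}^x (x - ξ)^(β - 1) u(ξ) dξ`. -/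
def leftIntegral {n : ℕ} (β : ℝ) (u : ℝ → Vec n) (x : ℝ) : Vec n :=
  (1 / Real.Gamma β) • ∫ ξ in Set.Iio x, (x - ξ) ^ (β - 1) • u ξ

/-- The left Liouville–Weyl fractional derivative of order `α`, the derivative of the
left fractional integral of order `1 - α`. -/
def leftDeriv {n : ℕ} (α : ℝ) (u : ℝ → Vec n) (x : ℝ) : Vec n :=
  deriv (leftIntegral (1 - α) u) x

/-- The pairs `(φ, D^α φ)` in `L² × L²`, for `φ ∈ C₀^∞(ℝ, ℝⁿ)`. -/
def testGraph (n : ℕ) (α : ℝ) : Set (L2 n × L2 n) :=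
  {p | ∃ φ : ℝ → Vec n, ContDiff ℝ ∞ φ ∧ HasCompactSupport φ ∧
    (p.1 : ℝ → Vec n) =ᵐ[volume] φ ∧ (p.2 : ℝ → Vec n) =ᵐ[volume] leftDeriv α φ}

/-- The space `I^α_{-∞}(ℝ, ℝⁿ) = H^α(ℝ, ℝⁿ)`: the completion of `C₀^∞(ℝ, ℝⁿ)` for the norm
`(‖u‖² + ‖D^α u‖²)^(1/2)` (both norms in `L²`), realized as the closure in `L² × L²` of the graph
of `D^α` on `C₀^∞`. An element is a pair `(u, g)`: the function `u` and its fractional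
derivative `g = D^α u`, the `L²`-limit of `D^α φ_k` along test functions `φ_k → u`.
(`testGraph` is already a linear subspace; `span` only records this.) -/
def fracSobolev (n : ℕ) (α : ℝ) : Submodule ℝ (L2 n × L2 n) :=
  (Submodule.span ℝ (testGraph n α)).topologicalClosure

/-- Condition (L): `L` is continuous with symmetric positive definite values, and
`(L(t)x, x) ≥ l(t)|x|²` for a continuous positive `l` with `l(t) → +∞` as `|t| → ∞`. -/
structure CondL {n : ℕ} (L : ℝ → Matrix (Fin n) (Fin n) ℝ) : Prop where
  continuous : Continuous L
  posDef : ∀ t, (L t).PosDef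
  coercive : ∃ l : ℝ → ℝ, Continuous l ∧ (∀ t, 0 < l t) ∧ Tendsto l (cocompact ℝ) atTop ∧
    ∀ (t : ℝ) (x : Vec n), l t * ‖x‖ ^ 2 ≤ inner ℝ (matVec (L t) x) x

/-- Condition (W₁); the gradient is taken in the second variable. -/
def CondW1 {n : ℕ} (W : ℝ → Vec n → ℝ) : Prop :=
  ContDiff ℝ 1 (fun p : ℝ × Vec n => W p.1 p.2) ∧
  ∃ μ : ℝ, 2 < μ ∧ ∀ (t : ℝ) (x : Vec n), x ≠ 0 →
    0 < μ * W t x ∧ μ * W t x ≤ inner ℝ x (gradient (W t) x)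

/-- Condition (W₂): `|∇W(t,x)| = o(|x|)` as `x → 0`, uniformly in `t`. -/
def CondW2 {n : ℕ} (W : ℝ → Vec n → ℝ) : Prop :=
  ∀ ε : ℝ, 0 < ε → ∃ δ : ℝ, 0 < δ ∧ ∀ (t : ℝ) (x : Vec n), ‖x‖ < δ →
    ‖gradient (W t) x‖ ≤ ε * ‖x‖

section Form

variable {n : ℕ}

theorem inner_matVec (M : Matrix (Fin n) (Fin n) ℝ) (x y : Vec n) :
    inner ℝ (matVec M x) y = ∑ i, ∑ j, M i j * x j * y i := by
  simp only [matVec, PiLp.inner_apply, Matrix.mulVec, dotProduct]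
  refine Finset.sum_congr rfl fun i _ => ?_
  simp [Finset.mul_sum, mul_comm]

theorem matVec_add (M : Matrix (Fin n) (Fin n) ℝ) (x y : Vec n) :
    matVec M (x + y) = matVec M x + matVec M y := by
  simp [matVec, Matrix.mulVec_add]

theorem matVec_smul (M : Matrix (Fin n) (Fin n) ℝ) (c : ℝ) (x : Vec n) :
    matVec M (c • x) = c • matVec M x := by
  simp [matVec, Matrix.mulVec_smul]

theorem inner_matVec_comm {L : ℝ → Matrix (Fin n) (Fin n) ℝ} (hL : CondL L) (t : ℝ)
    (x y : Vec n) : inner ℝ (matVec (L t) x) y = inner ℝ (matVec (L t) y) x := by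
  rw [inner_matVec, inner_matVec, Finset.sum_comm]
  refine Finset.sum_congr rfl fun i _ => Finset.sum_congr rfl fun j _ => ?_
  have h : L t j i = L t i j := by simpa using (hL.posDef t).isHermitian.apply i j
  rw [h]; ring

theorem inner_matVec_nonneg {L : ℝ → Matrix (Fin n) (Fin n) ℝ} (hL : CondL L) (t : ℝ)
    (x : Vec n) : 0 ≤ inner ℝ (matVec (L t) x) x := by
  obtain ⟨l, -, h0, -, h⟩ := hL.coercive
  exact le_trans (mul_nonneg (h0 t).le (sq_nonneg _)) (h t x)

theorem abs_inner_matVec_le {L : ℝ → Matrix (Fin n) (Fin n) ℝ} (hL : CondL L) (t : ℝ)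
    (x y : Vec n) : |inner ℝ (matVec (L t) x) y| ≤
      inner ℝ (matVec (L t) x) x + inner ℝ (matVec (L t) y) y := by
  have hc := inner_matVec_comm hL t x y
  have h1 := inner_matVec_nonneg hL t (x + y)
  have h2 := inner_matVec_nonneg hL t (x + (-1 : ℝ) • y)
  have hx := inner_matVec_nonneg hL t x
  have hy := inner_matVec_nonneg hL t y
  simp only [matVec_add, matVec_smul, inner_add_left, inner_add_right, inner_smul_left,
    inner_smul_right, ← hc] at h1 h2
  simp at h2
  rw [abs_le]
  constructor <;> linarith

theorem aestronglyMeasurable_coord (u : L2 n) (i : Fin n) :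
    AEStronglyMeasurable (fun t => u t i) volume :=
  (EuclideanSpace.proj (𝕜 := ℝ) i : Vec n →L[ℝ] ℝ).continuous.comp_aestronglyMeasurable
    (Lp.aestronglyMeasurable u)

theorem aestronglyMeasurable_form {L : ℝ → Matrix (Fin n) (Fin n) ℝ} (hL : CondL L)
    (u v : L2 n) :
    AEStronglyMeasurable (fun t => inner ℝ (matVec (L t) (u t)) (v t)) volume := by
  simp only [inner_matVec]
  refine Finset.aestronglyMeasurable_fun_sum _ fun i _ =>
    Finset.aestronglyMeasurable_fun_sum _ fun j _ => ?_
  exact ((hL.continuous.matrix_elem i j).aestronglyMeasurable.mul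
    (aestronglyMeasurable_coord u j)).mul (aestronglyMeasurable_coord v i)

theorem integrable_form {L : ℝ → Matrix (Fin n) (Fin n) ℝ} (hL : CondL L) {u v : L2 n}
    (hu : Integrable fun t => inner ℝ (matVec (L t) (u t)) (u t))
    (hv : Integrable fun t => inner ℝ (matVec (L t) (v t)) (v t)) :
    Integrable fun t => inner ℝ (matVec (L t) (u t)) (v t) :=
  (hu.add hv).mono' (aestronglyMeasurable_form hL u v)
    (Eventually.of_forall fun t => abs_inner_matVec_le hL t _ _)

end Form

/-- The space `X^α` of all `u ∈ H^α(ℝ, ℝⁿ)` with `∫ |D^α u|² + (L u, u) dt < ∞`, as a linear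
subspace (`|D^α u|²` is integrable for every `u ∈ H^α`). -/
def xSubmodule {n : ℕ} (α : ℝ) {L : ℝ → Matrix (Fin n) (Fin n) ℝ} (hL : CondL L) :
    Submodule ℝ (L2 n × L2 n) where
  carrier := {p | p ∈ fracSobolev n α ∧
    Integrable fun t => inner ℝ (matVec (L t) (p.1 t)) (p.1 t)}
  zero_mem' := by
    refine ⟨Submodule.zero_mem _, ?_⟩
    refine (integrable_zero ℝ ℝ volume).congr ?_
    filter_upwards [Lp.coeFn_zero (Vec n) 2 (volume : Measure ℝ)] with t ht
    simp only [Prod.fst_zero, ht, Pi.zero_apply, inner_zero_right]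
  add_mem' := by
    rintro p q ⟨hp, hp'⟩ ⟨hq, hq'⟩
    refine ⟨Submodule.add_mem _ hp hq, ?_⟩
    refine (((hp'.add (integrable_form hL hp' hq')).add (integrable_form hL hq' hp')).add
      hq').congr ?_
    filter_upwards [Lp.coeFn_add p.1 q.1] with t ht
    simp only [Prod.fst_add, ht, Pi.add_apply, matVec_add, inner_add_left, inner_add_right]
    ring
  smul_mem' := by
    rintro c p ⟨hp, hp'⟩
    refine ⟨Submodule.smul_mem _ c hp, ?_⟩
    refine (hp'.const_mul (c * c)).congr ?_
    filter_upwards [Lp.coeFn_smul c p.1] with t ht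
    simp only [Prod.smul_fst, ht, Pi.smul_apply, matVec_smul, inner_smul_left, inner_smul_right]
    simp [mul_assoc]

/-- The space `X^α`, which carries its own inner product below (not the one of `L² × L²`). -/
def XSpace {n : ℕ} (α : ℝ) {L : ℝ → Matrix (Fin n) (Fin n) ℝ} (hL : CondL L) : Type :=
  ↥(xSubmodule α hL)

namespace XSpace

variable {n : ℕ} {α : ℝ} {L : ℝ → Matrix (Fin n) (Fin n) ℝ} {hL : CondL L}

instance : AddCommGroup (XSpace α hL) := inferInstanceAs (AddCommGroup ↥(xSubmodule α hL))

instance : Module ℝ (XSpace α hL) := inferInstanceAs (Module ℝ ↥(xSubmodule α hL))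

/-- The function `u ∈ L²` underlying an element of `X^α`. -/
def fn (u : XSpace α hL) : L2 n := u.1.1

/-- The fractional derivative `D^α u ∈ L²` of an element of `X^α`. -/
def D (u : XSpace α hL) : L2 n := u.1.2

theorem fn_add (u v : XSpace α hL) : (u + v).fn = u.fn + v.fn := rfl

theorem D_add (u v : XSpace α hL) : (u + v).D = u.D + v.D := rfl

theorem fn_smul (c : ℝ) (u : XSpace α hL) : (c • u).fn = c • u.fn := rfl

theorem D_smul (c : ℝ) (u : XSpace α hL) : (c • u).D = c • u.D := rfl

theorem ext_pair {u v : XSpace α hL} (h1 : u.fn = v.fn) (h2 : u.D = v.D) : u = v :=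
  Subtype.ext (Prod.ext h1 h2)

/-- The inner product `⟨u, v⟩ = ∫ (D^α u, D^α v) + (L(t) u, v) dt` of `X^α`. -/
def form (u v : XSpace α hL) : ℝ :=
  ∫ t, (inner ℝ (u.D t) (v.D t) + inner ℝ (matVec (L t) (u.fn t)) (v.fn t))

theorem integrable_D (u v : XSpace α hL) : Integrable fun t => inner ℝ (u.D t) (v.D t) :=
  L2.integrable_inner (𝕜 := ℝ) u.D v.D

theorem integrable_L (u v : XSpace α hL) :
    Integrable fun t => inner ℝ (matVec (L t) (u.fn t)) (v.fn t) :=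
  integrable_form hL u.2.2 v.2.2

theorem form_comm (u v : XSpace α hL) : form v u = form u v := by
  refine integral_congr_ae (Eventually.of_forall fun t => ?_)
  simp only [inner_matVec_comm hL t (v.fn t) (u.fn t), real_inner_comm]

theorem form_self_nonneg (u : XSpace α hL) : 0 ≤ form u u :=
  integral_nonneg fun t => add_nonneg real_inner_self_nonneg (inner_matVec_nonneg hL t _)

theorem form_add (u v w : XSpace α hL) : form (u + v) w = form u w + form v w := by
  refine Eq.trans (integral_congr_ae ?_) (integral_add
    ((integrable_D u w).add (integrable_L u w)) ((integrable_D v w).add (integrable_L v w)))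
  filter_upwards [Lp.coeFn_add u.fn v.fn, Lp.coeFn_add u.D v.D] with t h1 h2
  simp only [fn_add, D_add, h1, h2, Pi.add_apply, matVec_add, inner_add_left]
  ring

theorem form_smul (c : ℝ) (u w : XSpace α hL) : form (c • u) w = c * form u w := by
  unfold form
  rw [← integral_const_mul]
  refine integral_congr_ae ?_
  filter_upwards [Lp.coeFn_smul c u.fn, Lp.coeFn_smul c u.D] with t h1 h2
  simp only [fn_smul, D_smul, h1, h2, Pi.smul_apply, matVec_smul, inner_smul_left]
  simp [mul_add]

theorem form_definite (u : XSpace α hL) (h : form u u = 0) : u = 0 := by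
  have hz := (integral_eq_zero_iff_of_nonneg
    (fun t => add_nonneg real_inner_self_nonneg (inner_matVec_nonneg hL t _))
    ((integrable_D u u).add (integrable_L u u))).1 h
  obtain ⟨l, -, h0, -, hl⟩ := hL.coercive
  have key : ∀ᵐ t, u.fn t = 0 ∧ u.D t = 0 := by
    filter_upwards [hz] with t ht
    have ht' : inner ℝ (u.D t) (u.D t) + inner ℝ (matVec (L t) (u.fn t)) (u.fn t) = 0 := ht
    have a : 0 ≤ inner ℝ (u.D t) (u.D t) := real_inner_self_nonneg
    have b := inner_matVec_nonneg hL t (u.fn t)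
    have a0 : inner ℝ (u.D t) (u.D t) = 0 := by linarith
    have b0 : l t * ‖u.fn t‖ ^ 2 ≤ 0 := by linarith [hl t (u.fn t)]
    refine ⟨?_, inner_self_eq_zero.1 a0⟩
    by_contra hne
    have := mul_pos (h0 t) (pow_pos (norm_pos_iff.2 hne) 2)
    linarith
  refine ext_pair ?_ ?_
  · exact (Lp.eq_zero_iff_ae_eq_zero).2 (key.mono fun t ht => ht.1)
  · exact (Lp.eq_zero_iff_ae_eq_zero).2 (key.mono fun t ht => ht.2)

/-- The inner product space structure of `X^α`. -/
@[reducible]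
def core : InnerProductSpace.Core ℝ (XSpace α hL) where
  inner := form
  conj_inner_symm u v := by simpa using form_comm u v
  re_inner_nonneg u := by simpa using form_self_nonneg u
  add_left := form_add
  smul_left u v c := by simpa using form_smul c u v
  definite := form_definite

instance : NormedAddCommGroup (XSpace α hL) :=
  @InnerProductSpace.Core.toNormedAddCommGroup ℝ (XSpace α hL) _ _ _ core

instance : InnerProductSpace ℝ (XSpace α hL) := InnerProductSpace.ofCore core.toCore

end XSpace

/-- The energy functional
`I(u) = ∫ [½ |D^α u|² + ½ (L(t) u, u) - W(t, u)] dt` on `X^α`. -/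
def energy {n : ℕ} {α : ℝ} {L : ℝ → Matrix (Fin n) (Fin n) ℝ} (hL : CondL L)
    (W : ℝ → Vec n → ℝ) (u : XSpace α hL) : ℝ :=
  (1 / 2) * (∫ t, (‖u.D t‖ ^ 2 + inner ℝ (matVec (L t) (u.fn t)) (u.fn t)))
    - ∫ t, W t (u.fn t)

/-- `u ∈ X^α` is a weak solution of the fractional Hamiltonian system:
`∫ [(D^α u, D^α v) + (L(t) u, v)] dt = ∫ (∇W(t, u), v) dt` for all `v ∈ X^α`, where the
integrals converge. -/
def IsWeakSolution {n : ℕ} {α : ℝ} {L : ℝ → Matrix (Fin n) (Fin n) ℝ} {hL : CondL L}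
    (W : ℝ → Vec n → ℝ) (u : XSpace α hL) : Prop :=
  ∀ v : XSpace α hL,
    Integrable (fun t => inner ℝ (u.D t) (v.D t) + inner ℝ (matVec (L t) (u.fn t)) (v.fn t)) ∧
    Integrable (fun t => inner ℝ (gradient (W t) (u.fn t)) (v.fn t)) ∧
    ∫ t, (inner ℝ (u.D t) (v.D t) + inner ℝ (matVec (L t) (u.fn t)) (v.fn t)) =
      ∫ t, inner ℝ (gradient (W t) (u.fn t)) (v.fn t)

/-- `u` is a critical point of `J` at a mountain-pass level: `J'(u) = 0`, `J(0) = 0`, there are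
`ρ, β > 0` and `e` with `J ≥ β` on the sphere of radius `ρ`, `‖e‖ > ρ`, `J(e) ≤ 0`, and
`J(u) = inf_γ max_s J(γ(s)) ≥ β` over the continuous paths `γ` from `0` to `e`. -/
def IsMountainPassPoint {X : Type*} [NormedAddCommGroup X] [NormedSpace ℝ X] (J : X → ℝ)
    (u : X) : Prop :=
  HasFDerivAt J (0 : X →L[ℝ] ℝ) u ∧ J 0 = 0 ∧
  ∃ (ρ β : ℝ) (e : X), 0 < ρ ∧ 0 < β ∧ (∀ w : X, ‖w‖ = ρ → β ≤ J w) ∧ ρ < ‖e‖ ∧ J e ≤ 0 ∧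
    β ≤ J u ∧
    IsGLB {m : ℝ | ∃ γ : C(unitInterval, X), γ 0 = 0 ∧ γ 1 = e ∧
      IsGreatest (Set.range fun s => J (γ s)) m} (J u)

end FracHam

end

/-! The solution is a mountain-pass critical point of the energy `I` on the Hilbert space `X^α`.
Near `0`, condition (W₂) makes `∫ W(t,u)` at most a quarter of `‖u‖²`, so `I` is positive on a small
sphere (`exists_sphere`). Along a ray, (W₁) makes `W` grow at least like `s^μ` with `μ > 2`, so `I`
becomes nonpositive far out (`exists_energy_nonpos`). Every path from `0` to such a point crosses
the sphere. Ekeland's principle on the complete space of paths gives almost critical points at the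
minimax level (`exists_almost_critical_of_path`), and the Palais–Smale condition turns them into a
critical point (`mountain_pass`).

The analytic input is the embedding of `H^α` into Hölder functions, which needs `α > 1/2`. A test
function is the fractional integral of order `α` of its derivative `D^α φ`, because the kernels
`x₊^(α-1)` and `x₊^(-α)` convolve to a constant on the half-line (Beta integral). Hence `φ(t+h) -
φ(t)` is `D^α φ` integrated against a difference of kernels whose `L²` norm is a multiple of
`h^(α-1/2)`. To avoid continuous representatives, the estimate is passed to the closure as a bound
between `u` and its averages over intervals of length `r` (`ae_norm_sub_average_le`).

This bound has three consequences: `X^α` embeds into `L^∞`; since `l(t) → ∞`, bounded sets of `X^α`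
are uniformly small at infinity; and bounded sequences have almost everywhere convergent
subsequences, because averages are weakly continuous. With the first two, `∇W(t,u)` is controlled
without any growth condition on `W` for large `x`. With all three, `u ↦ ∇W(·,u)` sends bounded
sequences to sequences with an `L²` convergent subsequence (`cauchySeq_nemytskii`). So the gradient
of `I` is the identity minus a compact map. Palais–Smale sequences are bounded by (W₁), and they
converge along a subsequence. -/

noncomputable section

namespace FracHam

/-! ### Ekeland's variational principle -/

/-- **Ekeland's variational principle** (weak form). -/
theorem exists_ekeland_point {X : Type*} [MetricSpace X] [CompleteSpace X] {f : X → ℝ}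
    (hf : LowerSemicontinuous f) (hb : BddBelow (Set.range f)) {ε : ℝ} (hε : 0 < ε) (x₀ : X) :
    ∃ x, f x ≤ f x₀ ∧ ∀ y, f x ≤ f y + ε * dist y x := by
  let S : X → Set X := fun x => {y | f y + ε * dist y x ≤ f x}
  have hself : ∀ x, x ∈ S x := fun x => by simp [S]
  have htrans : ∀ {x y z}, y ∈ S x → z ∈ S y → z ∈ S x := by
    intro x y z hy hz
    simp only [S, Set.mem_ofPred_eq] at *
    have := mul_le_mul_of_nonneg_left (dist_triangle z y x) hε.le
    linarith
  have hbd : ∀ x, BddBelow (f '' S x) := fun x => hb.mono (Set.image_subset_range _ _)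
  have hstep : ∀ (x : X) (k : ℕ), ∃ y ∈ S x, f y < sInf (f '' S x) + (1 / 2 : ℝ) ^ k := by
    intro x k
    obtain ⟨_, ⟨y, hy, rfl⟩, h⟩ := Real.lt_sInf_add_pos (s := f '' S x)
      ⟨_, x, hself x, rfl⟩ (ε := (1 / 2 : ℝ) ^ k) (by positivity)
    exact ⟨y, hy, h⟩
  choose N hN hN' using hstep
  let x : ℕ → X := fun k => Nat.rec x₀ (fun k y => N y k) k
  have hx : ∀ k, x (k + 1) = N (x k) k := fun k => rfl
  have hS : ∀ k, x (k + 1) ∈ S (x k) := fun k => by rw [hx]; exact hN _ _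
  have hmono : ∀ k m, k ≤ m → x m ∈ S (x k) := by
    intro k m hkm
    induction m, hkm using Nat.le_induction with
    | base => exact hself _
    | succ m _ ih => exact htrans ih (hS m)
  have hanti : Antitone (f ∘ x) := by
    refine antitone_nat_of_succ_le fun k => ?_
    have h : f (x (k + 1)) + ε * dist (x (k + 1)) (x k) ≤ f (x k) := hS k
    have := mul_nonneg hε.le (dist_nonneg (x := x (k + 1)) (y := x k))
    simp only [Function.comp]; linarith
  have hbx : BddBelow (Set.range (f ∘ x)) := hb.mono (Set.range_comp_subset_range _ _)
  have hlim := tendsto_atTop_ciInf hanti hbx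
  -- The values `f (x k)` decrease to a limit, and `ε * dist (x m) (x k)` is at most the drop from
  -- `f (x k)` to `f (x m)`.
  have hC : CauchySeq x := by
    rw [Metric.cauchySeq_iff']
    intro δ hδ
    obtain ⟨k, hk⟩ := ((tendsto_order.1 hlim).2 _
      (lt_add_of_pos_right _ (mul_pos hε hδ))).exists
    refine ⟨k, fun m hm => ?_⟩
    have h1 : f (x m) + ε * dist (x m) (x k) ≤ f (x k) := hmono k m hm
    have h2 : (⨅ i, (f ∘ x) i) ≤ f (x m) := ciInf_le hbx m
    simp only [Function.comp] at hk h2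
    exact lt_of_mul_lt_mul_left (a := ε) (by linarith) hε.le
  obtain ⟨z, hz⟩ := cauchySeq_tendsto_of_complete hC
  have hzS : ∀ k, z ∈ S (x k) := by
    intro k
    have hcl : IsClosed (S (x k)) := by
      have : LowerSemicontinuous fun y => f y + ε * dist y (x k) :=
        hf.add (Continuous.lowerSemicontinuous (by fun_prop))
      exact this.isClosed_preimage (f (x k))
    exact hcl.mem_of_tendsto hz ((eventually_ge_atTop k).mono fun m hm => hmono k m hm)
  have hfz : ∀ k, f z ≤ f (x k) := fun k => by
    have h : f z + ε * dist z (x k) ≤ f (x k) := hzS k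
    have := mul_nonneg hε.le (dist_nonneg (x := z) (y := x k))
    linarith
  refine ⟨z, hfz 0, fun y => ?_⟩
  by_contra! hy
  have hyS : y ∈ S z := hy.le
  -- Such a `y` lies in every `S (x k)`, and `x (k + 1)` was chosen within `2^(-k)` of the infimum
  -- of `f` there.
  have hle : f z ≤ f y := by
    have h0 : Tendsto (fun k : ℕ => f y + (1 / 2 : ℝ) ^ k) atTop (𝓝 (f y + 0)) :=
      tendsto_const_nhds.add (tendsto_pow_atTop_nhds_zero_of_lt_one (by norm_num) (by norm_num))
    rw [add_zero] at h0
    refine ge_of_tendsto' h0 fun k => ?_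
    have h1 := hN' (x k) k
    have h2 : sInf (f '' S (x k)) ≤ f y := csInf_le (hbd _) ⟨y, htrans (hzS k) hyS, rfl⟩
    have h3 := hfz (k + 1)
    rw [hx] at h3
    linarith
  have := mul_nonneg hε.le (dist_nonneg (x := y) (y := z))
  linarith

/-! ### The mountain pass theorem -/

section MountainPass

/-- The maximum of `J` along a path. -/
def pathMax {X : Type*} [TopologicalSpace X] (J : X → ℝ) (γ : C(unitInterval, X)) : ℝ :=
  ⨆ s, J (γ s)

theorem isGreatest_pathMax {X : Type*} [TopologicalSpace X] {J : X → ℝ}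
    (hJ : Continuous J) (γ : C(unitInterval, X)) :
    IsGreatest (Set.range fun s => J (γ s)) (pathMax J γ) :=
  (isCompact_range (hJ.comp γ.continuous)).isGreatest_sSup (Set.range_nonempty _)

theorem lowerSemicontinuous_pathMax {X : Type*} [TopologicalSpace X] {J : X → ℝ}
    (hJ : Continuous J) :
    LowerSemicontinuous (pathMax J) := by
  refine lowerSemicontinuous_ciSup (fun γ => (isGreatest_pathMax hJ γ).bddAbove) fun s => ?_
  exact (hJ.comp (continuous_eval_const s)).lowerSemicontinuous

variable {X : Type*} [NormedAddCommGroup X] [InnerProductSpace ℝ X]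

/-- A path that nearly minimizes `pathMax` among its small perturbations carries an almost
critical point at its maximal level. -/
theorem exists_almost_critical_of_path {J : X → ℝ} {g : X → X}
    (hJ : ∀ x, HasFDerivAt J (innerSL ℝ (g x)) x) (hg : Continuous g)
    (γ : C(unitInterval, X)) (h0 : J (γ 0) < pathMax J γ) (h1 : J (γ 1) < pathMax J γ)
    {ε : ℝ} (hε : 0 < ε)
    (hmin : ∀ η : C(unitInterval, X), η 0 = γ 0 → η 1 = γ 1 →
      pathMax J γ ≤ pathMax J η + ε * dist η γ) :
    ∃ s, J (γ s) = pathMax J γ ∧ ‖g (γ s)‖ ≤ 2 * ε := by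
  have hJc : Continuous J := continuous_iff_continuousAt.2 fun x => (hJ x).continuousAt
  set M := pathMax J γ with hM
  by_contra! hcon
  set m := max (J (γ 0)) (J (γ 1)) with hm
  have hmM : 0 < M - m := sub_pos.2 (max_lt h0 h1)
  have hJM : ∀ s, J (γ s) ≤ M := fun s => (isGreatest_pathMax hJc γ).2 ⟨s, rfl⟩
  -- The path is pushed down its gradient. The cutoff `χ` is `1` at the maximal level and `0` at the
  -- level of the endpoints, which therefore stay fixed. Dividing by `max ‖g‖ (2ε)` keeps the field
  -- `v` continuous with norm at most `1`; at a maximum this denominator is `‖g‖`, by the assumption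
  -- to be refuted.
  let χ : unitInterval → ℝ := fun s => max 0 ((J (γ s) - m) / (M - m))
  have hχ0 : ∀ s, 0 ≤ χ s := fun s => le_max_left _ _
  have hχ1 : ∀ s, χ s ≤ 1 := fun s =>
    max_le zero_le_one ((div_le_one hmM).2 (by linarith [hJM s]))
  have hden : ∀ s, 0 < max ‖g (γ s)‖ (2 * ε) := fun s => lt_max_of_lt_right (by positivity)
  let v : C(unitInterval, X) := ⟨fun s => -((χ s / max ‖g (γ s)‖ (2 * ε)) • g (γ s)), by
    have hχc : Continuous χ := by
      have := hJc.comp γ.continuous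
      exact continuous_const.max ((this.sub continuous_const).div_const _)
    have hgc : Continuous fun s => g (γ s) := hg.comp γ.continuous
    exact ((hχc.div (hgc.norm.max continuous_const) fun s => (hden s).ne').smul hgc).neg⟩
  have hvs : ∀ s, v s = -((χ s / max ‖g (γ s)‖ (2 * ε)) • g (γ s)) := fun s => rfl
  have hv1 : ∀ s, ‖v s‖ ≤ 1 := by
    intro s
    rw [hvs, norm_neg, norm_smul, Real.norm_of_nonneg (div_nonneg (hχ0 s) (hden s).le),
      div_mul_eq_mul_div, div_le_one (hden s)]
    exact (mul_le_of_le_one_left (norm_nonneg _) (hχ1 s)).trans (le_max_left _ _)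
  have hv_zero : ∀ s, J (γ s) ≤ m → v s = 0 := by
    intro s hs
    have : χ s = 0 := max_eq_left (div_nonpos_of_nonpos_of_nonneg (by linarith) hmM.le)
    simp [hvs, this]
  let h : ℕ → ℝ := fun k => 1 / ((k : ℝ) + 1)
  have hpos : ∀ k, 0 < h k := fun k => by positivity
  have hlim : Tendsto h atTop (𝓝 0) := tendsto_one_div_add_atTop_nhds_zero_nat
  have hex : ∀ k, ∃ s, M ≤ J (γ s + h k • v s) + ε * h k := by
    intro k
    obtain ⟨s, hs⟩ := (isGreatest_pathMax hJc (γ + h k • v)).1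
    refine ⟨s, ?_⟩
    have hd : dist (γ + h k • v) γ ≤ h k := by
      rw [ContinuousMap.dist_le (hpos k).le]
      intro s
      simp only [ContinuousMap.add_apply, ContinuousMap.smul_apply, dist_self_add_left, norm_smul,
        Real.norm_of_nonneg (hpos k).le]
      exact mul_le_of_le_one_right (hpos k).le (hv1 s)
    have := hmin (γ + h k • v) (by simp [hv_zero 0 (le_max_left _ _)])
      (by simp [hv_zero 1 (le_max_right _ _)])
    rw [← hs] at this
    have h2 := mul_le_mul_of_nonneg_left hd hε.le
    simp only [ContinuousMap.add_apply, ContinuousMap.smul_apply] at this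
    linarith
  choose s hs using hex
  obtain ⟨t, -, φ, hφ, ht⟩ := isCompact_univ.tendsto_subseq fun k => Set.mem_univ (s k)
  have hhφ : Tendsto (fun k => h (φ k)) atTop (𝓝 0) := hlim.comp hφ.tendsto_atTop
  have hb : Tendsto (fun k => γ (s (φ k))) atTop (𝓝 (γ t)) := (γ.continuous.tendsto t).comp ht
  have hv : Tendsto (fun k => v (s (φ k))) atTop (𝓝 (v t)) := (v.continuous.tendsto t).comp ht
  have ha : Tendsto (fun k => γ (s (φ k)) + h (φ k) • v (s (φ k))) atTop (𝓝 (γ t)) := by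
    simpa using hb.add (hhφ.smul hv)
  have htM : J (γ t) = M := by
    refine le_antisymm (hJM t) ?_
    have := ((hJc.tendsto _).comp ha).add (hhφ.const_mul ε)
    simp only [mul_zero, add_zero] at this
    exact ge_of_tendsto' this fun k => hs (φ k)
  -- Strict differentiability is needed because the base points `γ (s (φ k))` move with `k`.
  have hstrict : HasStrictFDerivAt J (innerSL ℝ (g (γ t))) (γ t) :=
    hasStrictFDerivAt_of_hasFDerivAt_of_continuousAt (Eventually.of_forall hJ)
      ((innerSL ℝ).continuous.comp hg).continuousAt
  have hsmall := (hstrict.isLittleO.comp_tendsto (ha.prodMk_nhds hb)).def (half_pos hε)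
  -- The constant `3/2 ε` is the loss `ε` per unit step allowed by near-minimality plus the
  -- differentiation error `ε/2`. It contradicts a slope below `-2ε` in the limit.
  have hlow : ∀ᶠ k in atTop, -(3 / 2 * ε) ≤ inner ℝ (g (γ t)) (v (s (φ k))) := by
    filter_upwards [hsmall] with k hk
    simp only [Function.comp, add_sub_cancel_left, innerSL_apply_apply, inner_smul_right,
      norm_smul, Real.norm_of_nonneg (hpos _).le] at hk
    have h1 := (abs_le.1 hk).2
    have h2 := hs (φ k)
    have h3 := hJM (s (φ k))
    have h4 : h (φ k) * ‖v (s (φ k))‖ ≤ h (φ k) := mul_le_of_le_one_right (hpos _).le (hv1 _)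
    have h5 := mul_le_mul_of_nonneg_left h4 (half_pos hε).le
    have h6 : h (φ k) * (-(3 / 2 * ε)) ≤ h (φ k) * inner ℝ (g (γ t)) (v (s (φ k))) := by
      linarith
    exact le_of_mul_le_mul_left h6 (hpos _)
  have hlow' : -(3 / 2 * ε) ≤ inner ℝ (g (γ t)) (v t) :=
    ge_of_tendsto ((continuous_const.inner continuous_id).continuousAt.tendsto.comp hv) hlow
  have hgt := hcon t htM
  have hχt : χ t = 1 := by
    simp only [χ, htM, div_self hmM.ne']
    norm_num
  rw [hvs, hχt, max_eq_left hgt.le, inner_neg_right, inner_smul_right,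
    real_inner_self_eq_norm_sq] at hlow'
  have hgp : 0 < ‖g (γ t)‖ := lt_trans (by positivity) hgt
  have : 1 / ‖g (γ t)‖ * ‖g (γ t)‖ ^ 2 = ‖g (γ t)‖ := by field_simp
  rw [this] at hlow'
  linarith

/-- The **mountain pass theorem** of Ambrosetti and Rabinowitz in a Hilbert space. -/
theorem mountain_pass [CompleteSpace X] {J : X → ℝ} {g : X → X}
    (hJ : ∀ x, HasFDerivAt J (innerSL ℝ (g x)) x) (hg : Continuous g)
    (hPS : ∀ (u : ℕ → X) (c : ℝ), Tendsto (fun k => J (u k)) atTop (𝓝 c) →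
      Tendsto (fun k => g (u k)) atTop (𝓝 0) →
      ∃ (x : X) (φ : ℕ → ℕ), StrictMono φ ∧ Tendsto (fun k => u (φ k)) atTop (𝓝 x))
    {ρ β : ℝ} {e : X} (hρ : 0 < ρ) (hβ : 0 < β) (hsphere : ∀ w, ‖w‖ = ρ → β ≤ J w)
    (he : ρ < ‖e‖) (hJ0 : J 0 = 0) (hJe : J e ≤ 0) :
    ∃ u, g u = 0 ∧ β ≤ J u ∧
      IsGLB {m : ℝ | ∃ γ : C(unitInterval, X), γ 0 = 0 ∧ γ 1 = e ∧
        IsGreatest (Set.range fun s => J (γ s)) m} (J u) := by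
  have hJc : Continuous J := continuous_iff_continuousAt.2 fun x => (hJ x).continuousAt
  let Γ : Set C(unitInterval, X) := {γ | γ 0 = 0 ∧ γ 1 = e}
  have hΓ : IsClosed Γ :=
    (isClosed_eq (continuous_eval_const _) continuous_const).inter
      (isClosed_eq (continuous_eval_const _) continuous_const)
  have : CompleteSpace Γ := hΓ.completeSpace_coe
  let Ψ : Γ → ℝ := fun γ => pathMax J γ
  have hΨ : LowerSemicontinuous Ψ :=
    (lowerSemicontinuous_pathMax hJc).comp continuous_subtype_val
  have hΨβ : ∀ γ, β ≤ Ψ γ := by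
    rintro ⟨γ, h0, h1⟩
    have hc : Continuous fun s => ‖γ s‖ := γ.continuous.norm
    obtain ⟨s, hs⟩ := mem_range_of_exists_le_of_exists_ge hc (c := ρ)
      ⟨0, by simp [h0, hρ.le]⟩ ⟨1, by simp [h1, he.le]⟩
    exact (hsphere _ hs).trans ((isGreatest_pathMax hJc γ).2 ⟨s, rfl⟩)
  have hbdd : BddBelow (Set.range Ψ) := ⟨β, by rintro _ ⟨γ, rfl⟩; exact hΨβ γ⟩
  let γ₀ : Γ := ⟨⟨fun s => (s : ℝ) • e, by fun_prop⟩, by simp, by simp⟩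
  have : Nonempty Γ := ⟨γ₀⟩
  set c := ⨅ γ, Ψ γ with hc
  have key : ∀ k : ℕ, ∃ x, c ≤ J x ∧ J x ≤ c + 1 / ((k : ℝ) + 1) ∧
      ‖g x‖ ≤ 2 * (1 / ((k : ℝ) + 1)) := by
    intro k
    have hε : (0 : ℝ) < 1 / ((k : ℝ) + 1) := by positivity
    obtain ⟨γ₁, hγ₁⟩ := exists_lt_of_ciInf_lt (lt_add_of_pos_right c hε)
    obtain ⟨γ, hγ, hmin⟩ := exists_ekeland_point hΨ hbdd hε γ₁
    obtain ⟨γ, hγ0, hγ1⟩ := γ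
    have hβγ : β ≤ pathMax J γ := hΨβ ⟨γ, hγ0, hγ1⟩
    obtain ⟨s, hs, hs'⟩ := exists_almost_critical_of_path hJ hg γ
      (by rw [hγ0, hJ0]; linarith) (by rw [hγ1]; linarith) hε
      (fun η h0 h1 => hmin ⟨η, h0.trans hγ0, h1.trans hγ1⟩)
    refine ⟨γ s, ?_, ?_, hs'⟩
    · rw [hs]; exact ciInf_le hbdd ⟨γ, hγ0, hγ1⟩
    · rw [hs]; exact (hγ.trans_lt hγ₁).le
  choose u hu1 hu2 hu3 using key
  have hlim : Tendsto (fun k : ℕ => 1 / ((k : ℝ) + 1)) atTop (𝓝 0) :=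
    tendsto_one_div_add_atTop_nhds_zero_nat
  have hJu : Tendsto (fun k => J (u k)) atTop (𝓝 c) :=
    tendsto_of_tendsto_of_tendsto_of_le_of_le tendsto_const_nhds
      (by simpa using hlim.const_add c) hu1 hu2
  have hgu : Tendsto (fun k => g (u k)) atTop (𝓝 0) :=
    squeeze_zero_norm hu3 (by simpa using hlim.const_mul 2)
  obtain ⟨x, φ, hφ, hx⟩ := hPS u c hJu hgu
  have hJx : J x = c := tendsto_nhds_unique ((hJc.tendsto x).comp hx) (hJu.comp hφ.tendsto_atTop)
  have hgx : g x = 0 := tendsto_nhds_unique ((hg.tendsto x).comp hx) (hgu.comp hφ.tendsto_atTop)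
  refine ⟨x, hgx, hJx ▸ le_ciInf hΨβ, ?_⟩
  rw [hJx]
  suffices hset : {m : ℝ | ∃ γ : C(unitInterval, X), γ 0 = 0 ∧ γ 1 = e ∧
      IsGreatest (Set.range fun s => J (γ s)) m} = Set.range Ψ by
    rw [hset]
    exact isGLB_ciInf hbdd
  ext m
  constructor
  · rintro ⟨γ, h0, h1, hm⟩
    exact ⟨⟨γ, h0, h1⟩, (isGreatest_pathMax hJc γ).unique hm⟩
  · rintro ⟨⟨γ, h0, h1⟩, rfl⟩
    exact ⟨γ, h0, h1, isGreatest_pathMax hJc γ⟩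

end MountainPass

/-! ### The kernels `x₊^(b - 1)` and their convolutions -/

section Kernel

open ContinuousLinearMap

/-- The truncated power `x₊^(b - 1)`. -/
def kern (b : ℝ) : ℝ → ℝ := (Set.Ioi 0).indicator fun x => x ^ (b - 1)

theorem kern_of_pos {b x : ℝ} (hx : 0 < x) : kern b x = x ^ (b - 1) :=
  Set.indicator_of_mem (Set.mem_Ioi.2 hx) _

theorem kern_of_nonpos {b x : ℝ} (hx : x ≤ 0) : kern b x = 0 :=
  Set.indicator_of_notMem (by simpa using hx) _

theorem kern_nonneg (b x : ℝ) : 0 ≤ kern b x :=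
  Set.indicator_nonneg (fun _ hx => Real.rpow_nonneg (le_of_lt hx) _) _

theorem measurable_kern (b : ℝ) : Measurable (kern b) :=
  (measurable_id.pow_const _).indicator measurableSet_Ioi

theorem integrableOn_kern {b : ℝ} (hb : 0 < b) (R : ℝ) : IntegrableOn (kern b) (Set.Iic R) := by
  rw [kern, IntegrableOn, integrable_indicator_iff measurableSet_Ioi, IntegrableOn,
    Measure.restrict_restrict measurableSet_Ioi, Set.Ioi_inter_Iic]
  rcases le_total R 0 with h | h
  · simp [Set.Ioc_eq_empty_of_le h]
  · exact (intervalIntegrable_iff_integrableOn_Ioc_of_le h).1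
      (intervalIntegral.intervalIntegrable_rpow' (by linarith))

theorem locallyIntegrable_kern {b : ℝ} (hb : 0 < b) : LocallyIntegrable (kern b) := by
  refine locallyIntegrable_iff.2 fun K hK => ?_
  obtain ⟨R, hR⟩ := hK.bddAbove
  exact (integrableOn_kern hb R).mono_set fun x hx => hR hx

theorem kern_scale {b h : ℝ} (hh : 0 < h) (x : ℝ) : kern b (h * x) = h ^ (b - 1) * kern b x := by
  rcases le_or_gt x 0 with hx | hx
  · rw [kern_of_nonpos hx, kern_of_nonpos (mul_nonpos_of_nonneg_of_nonpos hh.le hx), mul_zero]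
  · rw [kern_of_pos hx, kern_of_pos (mul_pos hh hx), Real.mul_rpow hh.le hx.le]

variable {E : Type*} [NormedAddCommGroup E] [NormedSpace ℝ E]

/-- The convolution of `x₊^(b - 1)` with a continuous function that vanishes near `-∞` exists. -/
theorem convolutionExistsAt_kern {F : Type*} [NormedAddCommGroup F] [NormedSpace ℝ F] {b : ℝ}
    (hb : 0 < b) (B : ℝ →L[ℝ] E →L[ℝ] F) {g : ℝ → E}
    (hg : Continuous g) {a : ℝ} (ha : ∀ x < a, g x = 0) (x : ℝ) :
    ConvolutionExistsAt (kern b) g x B := by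
  refine HasCompactSupport.convolutionExistsAt B ?_ (locallyIntegrable_kern hb) hg
  refine HasCompactSupport.intro (isCompact_Icc (a := 0) (b := x - a)) fun t ht => ?_
  rcases lt_or_ge t 0 with h | h
  · simp [kern_of_nonpos h.le]
  · have : x - a < t := by
      by_contra! h'
      exact ht ⟨h, h'⟩
    simp [ha (x - t) (by linarith)]

theorem convolution_kern_eq_zero {F : Type*} [NormedAddCommGroup F] [NormedSpace ℝ F] {b : ℝ}
    (B : ℝ →L[ℝ] E →L[ℝ] F) {g : ℝ → E} {a : ℝ} (ha : ∀ x < a, g x = 0)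
    {x : ℝ} (hx : x < a) : (convolution (kern b) g B volume) x = 0 := by
  rw [convolution_def]
  refine integral_eq_zero_of_ae (Eventually.of_forall fun t => ?_)
  rcases le_or_gt t 0 with h | h
  · simp [kern_of_nonpos h]
  · simp [ha (x - t) (by linarith)]

/-- Where the product is nonzero, `t` and `y - t` are positive with sum `y < R`, so truncation at
`R` changes nothing. The truncated kernels are integrable, which gives existence of the convolution
almost everywhere. -/
theorem kern_mul_kern_of_lt {a b R y : ℝ} (hy : y < R) (t : ℝ) :
    (Set.Iic R).indicator (kern a) t * (Set.Iic R).indicator (kern b) (y - t) =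
      kern a t * kern b (y - t) := by
  rcases le_or_gt t 0 with h | h
  · simp [Set.indicator_apply, kern_of_nonpos h]
  rcases le_or_gt (y - t) 0 with h' | h'
  · simp [Set.indicator_apply, kern_of_nonpos h']
  rw [Set.indicator_of_mem (by simp; linarith), Set.indicator_of_mem (by simp; linarith)]

theorem ae_convolutionExistsAt_kern_kern {a b : ℝ} (ha : 0 < a) (hb : 0 < b) :
    ∀ᵐ y : ℝ, ConvolutionExistsAt (kern a) (kern b) y (mul ℝ ℝ) := by
  have h : ∀ N : ℕ, ∀ᵐ y : ℝ, y < N →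
      ConvolutionExistsAt (kern a) (kern b) y (mul ℝ ℝ) := by
    intro N
    have h1 : Integrable ((Set.Iic (N : ℝ)).indicator (kern a)) :=
      (integrable_indicator_iff measurableSet_Iic).2 (integrableOn_kern ha N)
    have h2 : Integrable ((Set.Iic (N : ℝ)).indicator (kern b)) :=
      (integrable_indicator_iff measurableSet_Iic).2 (integrableOn_kern hb N)
    filter_upwards [h1.ae_convolution_exists (mul ℝ ℝ) h2] with y hy hyN
    refine Integrable.congr hy (Eventually.of_forall fun t => ?_)
    exact kern_mul_kern_of_lt hyN t
  filter_upwards [ae_all_iff.2 h] with y hy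
  obtain ⟨N, hN⟩ := exists_nat_gt y
  exact hy N hN

/-- `x₊^(a - 1) ⋆ x₊^(-a)` is the constant `Γ(a) Γ(1 - a)` on the positive half-line. -/
theorem convolution_kern_kern {a : ℝ} (ha : 0 < a) (ha' : a < 1) (y : ℝ) :
    (convolution (kern a) (kern (1 - a)) (mul ℝ ℝ) volume) y =
      (Set.Ioi 0).indicator (fun _ => Real.Gamma a * Real.Gamma (1 - a)) y := by
  rw [convolution_mul]
  rcases le_or_gt y 0 with hy | hy
  · rw [Set.indicator_of_notMem (by simpa using hy)]
    refine integral_eq_zero_of_ae (Eventually.of_forall fun t => ?_)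
    rcases le_or_gt t 0 with h | h
    · simp [kern_of_nonpos h]
    · simp [kern_of_nonpos (show y - t ≤ 0 by linarith)]
  rw [Set.indicator_of_mem (Set.mem_Ioi.2 hy)]
  have h1 : ∫ t, kern a t * kern (1 - a) (y - t) =
      ∫ t in (0 : ℝ)..y, t ^ (a - 1) * (y - t) ^ ((1 - a) - 1) := by
    rw [intervalIntegral.integral_of_le hy.le, integral_Ioc_eq_integral_Ioo,
      ← integral_indicator measurableSet_Ioo]
    refine integral_congr_ae (Eventually.of_forall fun t => ?_)
    simp only [Set.indicator_apply, Set.mem_Ioo]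
    split_ifs with h
    · rw [kern_of_pos h.1, kern_of_pos (sub_pos.2 h.2)]
    · rcases le_or_gt t 0 with h0 | h0
      · simp [kern_of_nonpos h0]
      · have : y - t ≤ 0 := by
          by_contra! h'
          exact h ⟨h0, by linarith⟩
        simp [kern_of_nonpos this]
  rw [h1]
  apply Complex.ofReal_injective
  rw [← intervalIntegral.integral_ofReal]
  have h2 := Complex.betaIntegral_scaled (a : ℂ) ((1 - a : ℝ) : ℂ) hy
  rw [Complex.betaIntegral_eq_Gamma_mul_div _ _ (by simpa) (by simpa), Complex.Gamma_ofReal,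
    Complex.Gamma_ofReal] at h2
  -- The exponents add up to `1`, so the power of `y` from rescaling the Beta integral disappears.
  have h3 : (a : ℂ) + ((1 - a : ℝ) : ℂ) = 1 := by push_cast; ring
  rw [h3, sub_self, Complex.cpow_zero, one_mul, Complex.Gamma_one, div_one,
    ← Complex.ofReal_mul] at h2
  rw [← h2]
  refine intervalIntegral.integral_congr_ae (Eventually.of_forall fun t ht => ?_)
  rw [Set.uIoc_of_le hy.le] at ht
  push_cast
  rw [Complex.ofReal_cpow ht.1.le, Complex.ofReal_cpow (sub_nonneg.2 ht.2)]
  push_cast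
  rfl

theorem convolution_heaviside_deriv [CompleteSpace E] {φ : ℝ → E} (hφ : ContDiff ℝ 1 φ)
    (hc : HasCompactSupport φ) (c x : ℝ) :
    (convolution ((Set.Ioi 0).indicator fun _ => c) (deriv φ) (lsmul ℝ ℝ) volume) x = c • φ x := by
  rw [convolution_lsmul_swap, ← hc.integral_Iic_deriv_eq hφ x, ← integral_smul,
    integral_Iic_eq_integral_Iio, ← integral_indicator measurableSet_Iio]
  refine integral_congr_ae (Eventually.of_forall fun t => ?_)
  simp only [Set.indicator_apply, Set.mem_Ioi, sub_pos, Set.mem_Iio]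
  split_ifs <;> simp

theorem exists_eq_zero_of_lt {F : Type*} [NormedAddCommGroup F] {φ : ℝ → F} (hc : HasCompactSupport φ) :
    ∃ a, ∀ x < a, φ x = 0 := by
  obtain ⟨a, ha⟩ := hc.isCompact.bddBelow
  exact ⟨a, fun x hx => image_eq_zero_of_notMem_tsupport fun h => (ha h).not_gt hx⟩

/-- Inverting the fractional integral of order `1 - a` of a derivative. -/
theorem convolution_kern_convolution_kern_deriv [CompleteSpace E] {a : ℝ} (ha : 0 < a)
    (ha' : a < 1) {φ : ℝ → E} (hφ : ContDiff ℝ 1 φ) (hc : HasCompactSupport φ) (x : ℝ) :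
    (convolution (kern a) (convolution (kern (1 - a)) (deriv φ) (lsmul ℝ ℝ) volume)
      (lsmul ℝ ℝ) volume) x = (Real.Gamma a * Real.Gamma (1 - a)) • φ x := by
  have hb : 0 < 1 - a := sub_pos.2 ha'
  have hd : Continuous (deriv φ) := hφ.continuous_deriv le_rfl
  have hn : ∀ b, (fun x => ‖kern b x‖) = kern b := fun b =>
    funext fun x => Real.norm_of_nonneg (kern_nonneg b x)
  obtain ⟨m, hm⟩ := exists_eq_zero_of_lt hc.deriv
  have hm' : ∀ x < m, ‖deriv φ x‖ = 0 := fun x hx => by simp [hm x hx]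
  rw [← convolution_assoc (mul ℝ ℝ) (lsmul ℝ ℝ) (lsmul ℝ ℝ) (lsmul ℝ ℝ)
    (fun x y z => mul_smul x y z) (measurable_kern a).aestronglyMeasurable
    (measurable_kern (1 - a)).aestronglyMeasurable hd.aestronglyMeasurable
    (ae_convolutionExistsAt_kern_kern ha hb)
    (Eventually.of_forall fun x => by
      rw [hn]
      exact convolutionExistsAt_kern hb (mul ℝ ℝ) hd.norm hm' x)
    (by
      rw [hn, hn]
      refine convolutionExistsAt_kern ha (mul ℝ ℝ) ?_ (a := m) ?_ x
      · exact HasCompactSupport.continuous_convolution_right _ hc.deriv.norm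
          (locallyIntegrable_kern hb) hd.norm
      · exact fun x hx => convolution_kern_eq_zero _ hm' hx),
    show convolution (kern a) (kern (1 - a)) (mul ℝ ℝ) volume = _ from
      funext (convolution_kern_kern ha ha'),
    convolution_heaviside_deriv hφ hc]

end Kernel

/-! ### Fractional calculus of test functions -/

section TestFunctions

open ContinuousLinearMap

variable {n : ℕ}

theorem leftIntegral_eq_convolution (b : ℝ) (u : ℝ → Vec n) :
    leftIntegral b u = (1 / Real.Gamma b) • convolution (kern b) u (lsmul ℝ ℝ) volume := by
  ext1 x
  rw [leftIntegral, Pi.smul_apply, convolution_lsmul_swap, ← integral_indicator measurableSet_Iio]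
  congr 1
  refine integral_congr_ae (Eventually.of_forall fun t => ?_)
  simp only [Set.indicator_apply, Set.mem_Iio]
  split_ifs with h
  · rw [kern_of_pos (sub_pos.2 h)]
  · rw [kern_of_nonpos (by linarith), zero_smul]

theorem hasDerivAt_leftIntegral {b : ℝ} (hb : 0 < b) {φ : ℝ → Vec n} (hφ : ContDiff ℝ 1 φ)
    (hc : HasCompactSupport φ) (x : ℝ) :
    HasDerivAt (leftIntegral b φ) (leftIntegral b (deriv φ) x) x := by
  rw [leftIntegral_eq_convolution, leftIntegral_eq_convolution]
  exact (hc.hasDerivAt_convolution_right (lsmul ℝ ℝ) (locallyIntegrable_kern hb) hφ x).const_smul _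

/-- The kernel is locally integrable and `φ` is `C¹` with compact support, so the derivative of the
convolution falls on `φ`. -/
theorem leftDeriv_eq_leftIntegral_deriv {α : ℝ} (hα' : α < 1) {φ : ℝ → Vec n}
    (hφ : ContDiff ℝ 1 φ) (hc : HasCompactSupport φ) :
    leftDeriv α φ = leftIntegral (1 - α) (deriv φ) :=
  funext fun x => (hasDerivAt_leftIntegral (sub_pos.2 hα') hφ hc x).deriv

theorem leftIntegral_add {b : ℝ} (hb : 0 < b) {φ ψ : ℝ → Vec n} (hφ : Continuous φ)
    (hφc : HasCompactSupport φ) (hψ : Continuous ψ) (hψc : HasCompactSupport ψ) :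
    leftIntegral b (φ + ψ) = leftIntegral b φ + leftIntegral b ψ := by
  simp only [leftIntegral_eq_convolution]
  rw [(hφc.convolutionExists_right _ (locallyIntegrable_kern hb) hφ).distrib_add
    (hψc.convolutionExists_right _ (locallyIntegrable_kern hb) hψ), smul_add]

theorem leftIntegral_smul (b c : ℝ) (φ : ℝ → Vec n) :
    leftIntegral b (c • φ) = c • leftIntegral b φ := by
  simp only [leftIntegral_eq_convolution]
  rw [convolution_smul, smul_comm]

theorem leftDeriv_add {α : ℝ} (hα' : α < 1) {φ ψ : ℝ → Vec n} (hφ : ContDiff ℝ 1 φ)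
    (hφc : HasCompactSupport φ) (hψ : ContDiff ℝ 1 ψ) (hψc : HasCompactSupport ψ) :
    leftDeriv α (φ + ψ) = leftDeriv α φ + leftDeriv α ψ := by
  have hb := sub_pos.2 hα'
  ext1 x
  rw [leftDeriv, leftIntegral_add hb hφ.continuous hφc hψ.continuous hψc]
  exact deriv_add (hasDerivAt_leftIntegral hb hφ hφc x).differentiableAt
    (hasDerivAt_leftIntegral hb hψ hψc x).differentiableAt

theorem leftDeriv_smul {α : ℝ} (c : ℝ) (hα' : α < 1) {φ : ℝ → Vec n} (hφ : ContDiff ℝ 1 φ)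
    (hφc : HasCompactSupport φ) : leftDeriv α (c • φ) = c • leftDeriv α φ := by
  ext1 x
  rw [leftDeriv, leftIntegral_smul]
  exact deriv_const_smul _ (hasDerivAt_leftIntegral (sub_pos.2 hα') hφ hφc x).differentiableAt

/-- `testGraph` is a linear subspace. -/
theorem span_testGraph (n : ℕ) {α : ℝ} (hα' : α < 1) :
    (Submodule.span ℝ (testGraph n α) : Set (L2 n × L2 n)) = testGraph n α := by
  refine Set.Subset.antisymm (fun p hp => ?_) Submodule.subset_span
  induction hp using Submodule.span_induction with
  | mem p hp => exact hp
  | zero =>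
    refine ⟨0, contDiff_const, HasCompactSupport.zero, Lp.coeFn_zero _ _ _, ?_⟩
    refine (Lp.coeFn_zero _ _ _).trans (Eventually.of_forall fun x => ?_)
    have : leftIntegral (1 - α) (0 : ℝ → Vec n) = fun _ => 0 := by
      ext1 x; simp [leftIntegral]
    simp [leftDeriv, this]
  | add p q _ _ hp hq =>
    obtain ⟨φ, hφ, hφc, h1, h2⟩ := hp
    obtain ⟨ψ, hψ, hψc, h3, h4⟩ := hq
    refine ⟨φ + ψ, hφ.add hψ, hφc.add hψc, ?_, ?_⟩
    · exact (Lp.coeFn_add _ _).trans (h1.add h3)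
    · rw [leftDeriv_add hα' (hφ.of_le (by simp)) hφc (hψ.of_le (by simp)) hψc]
      exact (Lp.coeFn_add _ _).trans (h2.add h4)
  | smul c p _ hp =>
    obtain ⟨φ, hφ, hφc, h1, h2⟩ := hp
    refine ⟨c • φ, contDiff_const.smul hφ, hφc.smul_left, ?_, ?_⟩
    · exact (Lp.coeFn_smul _ _).trans (h1.const_smul c)
    · rw [leftDeriv_smul c hα' (hφ.of_le (by simp)) hφc]
      exact (Lp.coeFn_smul _ _).trans (h2.const_smul c)

theorem continuous_leftDeriv {α : ℝ} (hα' : α < 1) {φ : ℝ → Vec n} (hφ : ContDiff ℝ 1 φ)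
    (hc : HasCompactSupport φ) : Continuous (leftDeriv α φ) := by
  rw [leftDeriv_eq_leftIntegral_deriv hα' hφ hc, leftIntegral_eq_convolution]
  exact (hc.deriv.continuous_convolution_right _ (locallyIntegrable_kern (sub_pos.2 hα'))
    (hφ.continuous_deriv le_rfl)).const_smul _

theorem leftDeriv_eq_zero {α : ℝ} (hα' : α < 1) {φ : ℝ → Vec n} (hφ : ContDiff ℝ 1 φ)
    (hc : HasCompactSupport φ) {a : ℝ} (ha : ∀ x < a, deriv φ x = 0) {x : ℝ} (hx : x < a) :
    leftDeriv α φ x = 0 := by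
  rw [leftDeriv_eq_leftIntegral_deriv hα' hφ hc, leftIntegral_eq_convolution, Pi.smul_apply,
    convolution_kern_eq_zero _ ha hx, smul_zero]

/-- A test function is recovered from its fractional derivative by fractional integration. -/
theorem leftIntegral_leftDeriv {α : ℝ} (hα : 0 < α) (hα' : α < 1) {φ : ℝ → Vec n}
    (hφ : ContDiff ℝ 1 φ) (hc : HasCompactSupport φ) :
    leftIntegral α (leftDeriv α φ) = φ := by
  have h1 := Real.Gamma_pos_of_pos hα
  have h2 := Real.Gamma_pos_of_pos (sub_pos.2 hα')
  ext1 x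
  rw [leftDeriv_eq_leftIntegral_deriv hα' hφ hc, leftIntegral_eq_convolution (1 - α),
    leftIntegral_smul, leftIntegral_eq_convolution, Pi.smul_apply, Pi.smul_apply,
    convolution_kern_convolution_kern_deriv hα hα' hφ hc, smul_smul, smul_smul]
  convert one_smul ℝ (φ x) using 2
  field_simp

end TestFunctions

/-! ### Cauchy–Schwarz for integrals -/

section CauchySchwarz

variable {Ω : Type*} [MeasurableSpace Ω] {μ : Measure Ω} {E : Type*} [NormedAddCommGroup E]
  [NormedSpace ℝ E]

theorem integral_mul_le_sqrt {f g : Ω → ℝ} (hf0 : ∀ x, 0 ≤ f x) (hg0 : ∀ x, 0 ≤ g x)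
    (hf : MemLp f 2 μ) (hg : MemLp g 2 μ) :
    ∫ x, f x * g x ∂μ ≤ √(∫ x, f x ^ 2 ∂μ) * √(∫ x, g x ^ 2 ∂μ) := by
  have h2 : ENNReal.ofReal 2 = 2 := by norm_num
  have := integral_mul_le_Lp_mul_Lq_of_nonneg (μ := μ) Real.HolderConjugate.two_two
    (Eventually.of_forall hf0) (Eventually.of_forall hg0) (by rwa [h2]) (by rwa [h2])
  simpa only [Real.sqrt_eq_rpow, Real.rpow_ofNat] using this

theorem norm_integral_smul_le_sqrt {f : Ω → ℝ} {g : Ω → E} (hf : MemLp f 2 μ)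
    (hg : MemLp g 2 μ) :
    ‖∫ x, f x • g x ∂μ‖ ≤ √(∫ x, f x ^ 2 ∂μ) * √(∫ x, ‖g x‖ ^ 2 ∂μ) := by
  refine (norm_integral_le_integral_norm _).trans ?_
  have := integral_mul_le_sqrt (fun x => norm_nonneg (f x)) (fun x => norm_nonneg (g x))
    hf.norm hg.norm
  simpa only [norm_smul, Real.norm_eq_abs, sq_abs] using this

theorem norm_integral_le_sqrt_mul_sqrt [IsFiniteMeasure μ] {g : Ω → E} (hg : MemLp g 2 μ) :
    ‖∫ x, g x ∂μ‖ ≤ √(μ.real Set.univ) * √(∫ x, ‖g x‖ ^ 2 ∂μ) := by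
  have := norm_integral_smul_le_sqrt (memLp_const (1 : ℝ) (p := 2) (μ := μ)) hg
  simpa using this

end CauchySchwarz

theorem norm_sq_L2 {n : ℕ} (u : L2 n) : ‖u‖ ^ 2 = ∫ t, ‖u t‖ ^ 2 := by
  rw [← real_inner_self_eq_norm_sq, L2.inner_def]
  simp only [real_inner_self_eq_norm_sq]

theorem norm_L2_eq_sqrt {n : ℕ} (u : L2 n) : ‖u‖ = √(∫ t, ‖u t‖ ^ 2) := by
  rw [← norm_sq_L2, Real.sqrt_sq (norm_nonneg _)]

theorem integrable_norm_sq {n : ℕ} (u : L2 n) : Integrable fun t => ‖u t‖ ^ 2 :=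
  (memLp_two_iff_integrable_sq_norm (Lp.aestronglyMeasurable u)).1 (Lp.memLp u)

/-! ### `L²` norm of a difference of kernels -/

section KernelDifference

/-- The first bound serves near `0`, the second near infinity. The second comes from the
monotonicity of `x ^ α`, which gives `(x+1)^(α-1) ≥ x^(α-1) · x/(x+1)`. -/
theorem abs_kern_add_one_sub_le {α x : ℝ} (hα : 0 < α) (hα' : α < 1) (hx : 0 < x) :
    |kern α (x + 1) - kern α x| ≤ x ^ (α - 1) ∧ |kern α (x + 1) - kern α x| ≤ x ^ (α - 2) := by
  rw [kern_of_pos hx, kern_of_pos (by linarith : 0 < x + 1)]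
  have h1 : (x + 1) ^ (α - 1) ≤ x ^ (α - 1) :=
    Real.rpow_le_rpow_of_nonpos hx (by linarith) (by linarith)
  have h0 : 0 ≤ (x + 1) ^ (α - 1) := Real.rpow_nonneg (by linarith) _
  have h2 : x ^ (α - 1) * (x / (x + 1)) ≤ (x + 1) ^ (α - 1) := by
    have e1 : x ^ (α - 1) * x = x ^ α := by
      rw [← Real.rpow_add_one hx.ne']; congr 1; ring
    have e2 : (x + 1) ^ (α - 1) * (x + 1) = (x + 1) ^ α := by
      rw [← Real.rpow_add_one (by linarith)]; congr 1; ring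
    rw [← mul_div_assoc, div_le_iff₀ (by linarith), e1, e2]
    exact Real.rpow_le_rpow hx.le (by linarith) hα.le
  rw [abs_sub_comm, abs_of_nonneg (sub_nonneg.2 h1)]
  refine ⟨by linarith, ?_⟩
  have h3 : x ^ (α - 2) = x ^ (α - 1) * (1 / x) := by
    rw [one_div, ← div_eq_mul_inv, ← Real.rpow_sub_one hx.ne']; congr 1; ring
  have h4 : 1 - x / (x + 1) ≤ 1 / x := by
    rw [one_sub_div (by linarith), add_sub_cancel_left]
    exact one_div_le_one_div_of_le hx (by linarith)
  have h5 := mul_le_mul_of_nonneg_left h4 (Real.rpow_nonneg hx.le (α - 1))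
  rw [h3]
  linarith

/-- The singularities at `-1` and `0` have exponent `2(α - 1) > -1`; this is where `α > 1/2` enters.
The tail has exponent `2(α - 2) < -1`. -/
theorem integrable_sq_kern_add_one_sub {α : ℝ} (hα : 1 / 2 < α) (hα' : α < 1) :
    Integrable fun x => (kern α (x + 1) - kern α x) ^ 2 := by
  have hm : Measurable fun x => (kern α (x + 1) - kern α x) ^ 2 :=
    (((measurable_kern α).comp (measurable_id.add_const 1)).sub (measurable_kern α)).pow_const 2
  have hsq : ∀ {x : ℝ}, 0 < x → ∀ c : ℝ, (x ^ c) ^ 2 = x ^ (2 * c) := fun {x} hx c => by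
    rw [mul_comm, Real.rpow_mul hx.le, Real.rpow_two]
  rw [← integrableOn_univ, ← Set.Iic_union_Ioi (a := (-1 : ℝ)),
    ← Set.Ioc_union_Ioi_eq_Ioi (show (-1 : ℝ) ≤ 0 by norm_num),
    ← Set.Ioc_union_Ioi_eq_Ioi (show (0 : ℝ) ≤ 1 by norm_num)]
  refine IntegrableOn.union ?_ (IntegrableOn.union ?_ (IntegrableOn.union ?_ ?_))
  · refine IntegrableOn.congr_fun integrableOn_zero (fun x hx => ?_) measurableSet_Iic
    have hx' : x ≤ -1 := hx
    simp [kern_of_nonpos (show x + 1 ≤ 0 by linarith), kern_of_nonpos (show x ≤ 0 by linarith)]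
  · have hi : IntervalIntegrable (fun x : ℝ => (x + 1) ^ (2 * (α - 1))) volume (0 - 1) (1 - 1) :=
      (intervalIntegral.intervalIntegrable_rpow' (a := 0) (b := 1)
        (by linarith : -1 < 2 * (α - 1))).comp_add_right 1
    norm_num at hi
    refine IntegrableOn.congr_fun ((intervalIntegrable_iff_integrableOn_Ioc_of_le
      (by norm_num)).1 hi) (fun x hx => ?_) measurableSet_Ioc
    have h1 : 0 < x + 1 := by linarith [hx.1]
    simp only [kern_of_nonpos hx.2, kern_of_pos h1, sub_zero, hsq h1]
  · have hi : IntervalIntegrable (fun x : ℝ => x ^ (2 * (α - 1))) volume 0 1 :=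
      intervalIntegral.intervalIntegrable_rpow' (by linarith)
    refine Integrable.mono' ((intervalIntegrable_iff_integrableOn_Ioc_of_le zero_le_one).1 hi)
      hm.aestronglyMeasurable ?_
    filter_upwards [ae_restrict_mem measurableSet_Ioc] with x hx
    rw [Real.norm_of_nonneg (sq_nonneg _), ← hsq hx.1, ← sq_abs]
    exact pow_le_pow_left₀ (abs_nonneg _) (abs_kern_add_one_sub_le (by linarith) hα' hx.1).1 2
  · refine Integrable.mono' (integrableOn_Ioi_rpow_of_lt
      (by linarith : 2 * (α - 2) < -1) zero_lt_one) hm.aestronglyMeasurable ?_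
    filter_upwards [ae_restrict_mem measurableSet_Ioi] with x hx
    have hx0 : 0 < x := zero_lt_one.trans hx
    rw [Real.norm_of_nonneg (sq_nonneg _), ← hsq hx0, ← sq_abs]
    exact pow_le_pow_left₀ (abs_nonneg _) (abs_kern_add_one_sub_le (by linarith) hα' hx0).2 2

theorem kern_add_sub_scale {α h : ℝ} (hh : 0 < h) (x : ℝ) :
    (kern α (h * x + h) - kern α (h * x)) ^ 2 =
      h ^ (2 * α - 2) * (kern α (x + 1) - kern α x) ^ 2 := by
  have h1 : h * x + h = h * (x + 1) := by ring
  have h2 : h ^ (2 * α - 2) = (h ^ (α - 1)) ^ 2 := by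
    rw [← Real.rpow_two, ← Real.rpow_mul hh.le]; congr 1; ring
  rw [h1, kern_scale hh, kern_scale hh, h2]
  ring

theorem memLp_kern_add_sub {α h : ℝ} (hα : 1 / 2 < α) (hα' : α < 1) (hh : 0 < h) :
    MemLp (fun x => kern α (x + h) - kern α x) 2 := by
  refine (memLp_two_iff_integrable_sq (((measurable_kern α).comp
    (measurable_id.add_const h)).sub (measurable_kern α)).aestronglyMeasurable).2 ?_
  rw [← integrable_comp_mul_left_iff _ hh.ne']
  simp only [Pi.sub_apply, Function.comp, id, kern_add_sub_scale hh]
  exact (integrable_sq_kern_add_one_sub hα hα').const_mul _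

/-- The substitution `x ↦ h x` contributes `h^(2α-2)` from homogeneity and `h` from the measure. The
square root gives the Hölder exponent `α - 1/2`. -/
theorem integral_sq_kern_add_sub {α h : ℝ} (hh : 0 < h) :
    ∫ x, (kern α (x + h) - kern α x) ^ 2 =
      h ^ (2 * α - 1) * ∫ x, (kern α (x + 1) - kern α x) ^ 2 := by
  have h1 := Measure.integral_comp_mul_left (fun x => (kern α (x + h) - kern α x) ^ 2) h
  simp only [kern_add_sub_scale hh, integral_const_mul, abs_of_pos (inv_pos.2 hh),
    smul_eq_mul] at h1
  rw [eq_comm, inv_mul_eq_iff_eq_mul₀ hh.ne', ← mul_assoc] at h1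
  rw [h1]
  congr 1
  rw [mul_comm, ← Real.rpow_add_one hh.ne']
  congr 1
  ring

/-- The constant of the embedding of `H^α` into `(α - 1/2)`-Hölder continuous functions. -/
def holderConst (α : ℝ) : ℝ :=
  √(∫ x, (kern α (x + 1) - kern α x) ^ 2) / Real.Gamma α

theorem holderConst_nonneg {α : ℝ} (hα : 0 < α) : 0 ≤ holderConst α :=
  div_nonneg (Real.sqrt_nonneg _) (Real.Gamma_pos_of_pos hα).le

end KernelDifference

/-! ### Hölder embedding, expressed through averages -/

section Holder

open ContinuousLinearMap

variable {n : ℕ} {α : ℝ}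

/-- Writing `φ` as the fractional integral of `D^α φ` turns the increment into `D^α φ` integrated
against a kernel difference; Cauchy–Schwarz finishes. -/
theorem norm_sub_le_of_test (hα : 1 / 2 < α) (hα' : α < 1) {φ : ℝ → Vec n}
    (hφ : ContDiff ℝ 1 φ) (hc : HasCompactSupport φ) {g : L2 n} (hg : g =ᵐ[volume] leftDeriv α φ)
    (t : ℝ) {h : ℝ} (hh : 0 < h) :
    ‖φ (t + h) - φ t‖ ≤ holderConst α * h ^ (α - 1 / 2) * ‖g‖ := by
  have hα0 : 0 < α := by linarith
  have hΓ := Real.Gamma_pos_of_pos hα0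
  obtain ⟨a, ha⟩ := exists_eq_zero_of_lt hc.deriv
  have hex : ∀ x, Integrable fun s => kern α (x - s) • leftDeriv α φ s := fun x =>
    (convolutionExistsAt_kern hα0 (lsmul ℝ ℝ) (continuous_leftDeriv hα' hφ hc)
      (fun x hx => leftDeriv_eq_zero hα' hφ hc ha hx) x).integrable_swap
  have hrep : ∀ x, φ x = (1 / Real.Gamma α) • ∫ s, kern α (x - s) • leftDeriv α φ s := by
    intro x
    conv_lhs => rw [← leftIntegral_leftDeriv hα0 hα' hφ hc, leftIntegral_eq_convolution,
      Pi.smul_apply, convolution_lsmul_swap]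
  rw [hrep (t + h), hrep t, ← smul_sub, ← integral_sub (hex _) (hex _), norm_smul,
    Real.norm_of_nonneg (by positivity)]
  have hmeas : MeasurePreserving (fun s : ℝ => t - s) := Measure.measurePreserving_sub_left _ t
  have h1 : ∫ s, (kern α (t + h - s) • leftDeriv α φ s - kern α (t - s) • leftDeriv α φ s) =
      ∫ s, (kern α (t - s + h) - kern α (t - s)) • g s := by
    refine integral_congr_ae ?_
    filter_upwards [hg] with s hs
    rw [hs, sub_smul, show t + h - s = t - s + h by ring]
  have h2 := norm_integral_smul_le_sqrt
    ((memLp_kern_add_sub hα hα' hh).comp_measurePreserving hmeas) (Lp.memLp g)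
  simp only [Function.comp] at h2
  rw [integral_sub_left_eq_self (fun x => (kern α (x + h) - kern α x) ^ 2) volume t,
    integral_sq_kern_add_sub hh, ← norm_L2_eq_sqrt, Real.sqrt_mul (Real.rpow_nonneg hh.le _)] at h2
  have h3 : √(h ^ (2 * α - 1)) = h ^ (α - 1 / 2) := by
    rw [Real.sqrt_eq_rpow, ← Real.rpow_mul hh.le]; congr 1; ring
  rw [h3] at h2
  rw [h1, holderConst, one_div, div_eq_inv_mul, mul_assoc, mul_assoc]
  refine mul_le_mul_of_nonneg_left (h2.trans (le_of_eq ?_)) (inv_nonneg.2 hΓ.le)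
  ring

/-- The average of `u` over `(t, t + r]`. -/
def average (r : ℝ) (u : L2 n) (t : ℝ) : Vec n := r⁻¹ • ∫ s in Set.Ioc t (t + r), u s

theorem memLp_Ioc (u : L2 n) (a b : ℝ) : MemLp u 2 (volume.restrict (Set.Ioc a b)) :=
  (Lp.memLp u).restrict _

theorem integrable_Ioc (u : L2 n) (a b : ℝ) : IntegrableOn u (Set.Ioc a b) :=
  (memLp_Ioc u a b).integrable one_le_two

theorem average_sub (r : ℝ) (u v : L2 n) (t : ℝ) :
    average r (u - v) t = average r u t - average r v t := by
  rw [average, average, average, ← smul_sub, ← integral_sub (integrable_Ioc _ _ _)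
    (integrable_Ioc _ _ _)]
  congr 1
  exact integral_congr_ae (ae_restrict_of_ae (Lp.coeFn_sub u v))

theorem norm_average_le {r : ℝ} (hr : 0 < r) (u : L2 n) (t : ℝ) :
    ‖average r u t‖ ≤ √(r⁻¹ * ∫ s in Set.Ioc t (t + r), ‖u s‖ ^ 2) := by
  have h := norm_integral_le_sqrt_mul_sqrt (memLp_Ioc u t (t + r))
  rw [measureReal_restrict_apply_univ, Real.volume_real_Ioc_of_le (by linarith),
    add_sub_cancel_left] at h
  rw [average, norm_smul, Real.norm_of_nonneg (inv_nonneg.2 hr.le),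
    Real.sqrt_mul (inv_nonneg.2 hr.le)]
  have h2 : r⁻¹ * √r = √r⁻¹ := by
    rw [Real.sqrt_inv]
    have := Real.sqrt_pos.2 hr
    rw [inv_mul_eq_iff_eq_mul₀ hr.ne', eq_mul_inv_iff_mul_eq₀ this.ne',
      Real.mul_self_sqrt hr.le]
  rw [← h2, mul_assoc]
  exact mul_le_mul_of_nonneg_left h (inv_nonneg.2 hr.le)

theorem norm_average_le_norm {r : ℝ} (hr : 0 < r) (u : L2 n) (t : ℝ) :
    ‖average r u t‖ ≤ √r⁻¹ * ‖u‖ := by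
  refine (norm_average_le hr u t).trans ?_
  rw [Real.sqrt_mul (inv_nonneg.2 hr.le), norm_L2_eq_sqrt]
  refine mul_le_mul_of_nonneg_left (Real.sqrt_le_sqrt ?_) (Real.sqrt_nonneg _)
  exact setIntegral_le_integral (integrable_norm_sq u)
    (Eventually.of_forall fun s => sq_nonneg _)

/-- The Hölder bound averaged over `(t, t + r]`. Unlike the pointwise bound, this form passes to
`L²` limits without choosing a continuous representative. -/
theorem ae_norm_sub_average_le_of_test (hα : 1 / 2 < α) (hα' : α < 1) {p : L2 n × L2 n}
    (hp : p ∈ testGraph n α) {r : ℝ} (hr : 0 < r) :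
    ∀ᵐ t, ‖p.1 t - average r p.1 t‖ ≤ holderConst α * r ^ (α - 1 / 2) * ‖p.2‖ := by
  obtain ⟨φ, hφ, hc, h1, h2⟩ := hp
  filter_upwards [h1] with t ht
  have hvol : (volume : Measure ℝ).real (Set.Ioc t (t + r)) = r := by
    rw [Real.volume_real_Ioc_of_le (by linarith), add_sub_cancel_left]
  have hav : average r p.1 t = r⁻¹ • ∫ s in Set.Ioc t (t + r), φ s := by
    rw [average]
    congr 1
    exact integral_congr_ae (ae_restrict_of_ae h1)
  have hInt : IntegrableOn φ (Set.Ioc t (t + r)) :=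
    (hφ.continuous.integrable_of_hasCompactSupport hc).integrableOn
  have heq : φ t - average r p.1 t = r⁻¹ • ∫ s in Set.Ioc t (t + r), (φ t - φ s) := by
    rw [integral_sub (integrable_const _) hInt, setIntegral_const, hvol, smul_sub, smul_smul,
      inv_mul_cancel₀ hr.ne', one_smul, hav]
  rw [ht, heq, norm_smul, Real.norm_of_nonneg (inv_nonneg.2 hr.le)]
  have hC : ∀ s ∈ Set.Ioc t (t + r),
      ‖φ t - φ s‖ ≤ holderConst α * r ^ (α - 1 / 2) * ‖p.2‖ := by
    intro s hs
    have h3 := norm_sub_le_of_test hα hα' (hφ.of_le (by simp)) hc h2 t (sub_pos.2 hs.1)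
    rw [add_sub_cancel] at h3
    rw [norm_sub_rev]
    refine h3.trans (mul_le_mul_of_nonneg_right (mul_le_mul_of_nonneg_left ?_
      (holderConst_nonneg (by linarith))) (norm_nonneg _))
    exact Real.rpow_le_rpow (sub_pos.2 hs.1).le (by linarith [hs.2]) (by linarith)
  have h4 := norm_setIntegral_le_of_norm_le_const (μ := volume)
    (measure_Ioc_lt_top (a := t) (b := t + r)) hC
  rw [hvol] at h4
  rw [inv_mul_le_iff₀ hr]
  linarith

theorem exists_subseq_ae_tendsto {u : ℕ → L2 n} {v : L2 n} (h : Tendsto u atTop (𝓝 v)) :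
    ∃ φ : ℕ → ℕ, StrictMono φ ∧ ∀ᵐ t, Tendsto (fun k => u (φ k) t) atTop (𝓝 (v t)) :=
  (tendstoInMeasure_of_tendsto_Lp h).exists_seq_tendsto_ae

theorem tendsto_average {u : ℕ → L2 n} {v : L2 n} (h : Tendsto u atTop (𝓝 v)) {r : ℝ}
    (hr : 0 < r) (t : ℝ) : Tendsto (fun k => average r (u k) t) atTop (𝓝 (average r v t)) := by
  rw [tendsto_iff_norm_sub_tendsto_zero] at h ⊢
  refine squeeze_zero (fun _ => norm_nonneg _) (fun k => ?_) 
    (by simpa only [mul_zero] using h.const_mul (√r⁻¹))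
  rw [← average_sub]
  exact norm_average_le_norm hr _ t

/-- Elements of `H^α` are uniformly close to their averages: this is the embedding of `H^α` into
Hölder continuous functions. -/
theorem ae_norm_sub_average_le (hα : 1 / 2 < α) (hα' : α < 1) {p : L2 n × L2 n}
    (hp : p ∈ fracSobolev n α) {r : ℝ} (hr : 0 < r) :
    ∀ᵐ t, ‖p.1 t - average r p.1 t‖ ≤ holderConst α * r ^ (α - 1 / 2) * ‖p.2‖ := by
  have hp' : p ∈ closure (testGraph n α) := by
    rw [← span_testGraph n hα']
    exact hp
  obtain ⟨q, hq, hlim⟩ := mem_closure_iff_seq_limit.1 hp'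
  have hlim1 : Tendsto (fun k => (q k).1) atTop (𝓝 p.1) := (continuous_fst.tendsto p).comp hlim
  have hlim2 : Tendsto (fun k => (q k).2) atTop (𝓝 p.2) := (continuous_snd.tendsto p).comp hlim
  obtain ⟨φ, hφ, hae⟩ := exists_subseq_ae_tendsto hlim1
  filter_upwards [hae, ae_all_iff.2 fun k => ae_norm_sub_average_le_of_test hα hα' (hq k) hr]
    with t ht hk
  refine le_of_tendsto_of_tendsto'
    ((ht.sub ((tendsto_average hlim1 hr t).comp hφ.tendsto_atTop)).norm)
    ((hlim2.comp hφ.tendsto_atTop).norm.const_mul _) fun k => hk (φ k)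

end Holder

/-! ### Nonzero elements of the test graph -/

section Nontrivial

open ContinuousLinearMap

variable {n : ℕ} {α : ℝ}

/-- `D^α φ` vanishes to the left of the support of `φ'` and is continuous. To the right it is `O((t
- b)^(-α))`, which is square integrable because `2α > 1`. -/
theorem memLp_leftDeriv (hα : 1 / 2 < α) (hα' : α < 1) {φ : ℝ → Vec n} (hφ : ContDiff ℝ 1 φ)
    (hc : HasCompactSupport φ) : MemLp (leftDeriv α φ) 2 := by
  have hcont := continuous_leftDeriv hα' hφ hc
  have hd : Continuous (deriv φ) := hφ.continuous_deriv le_rfl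
  obtain ⟨a, ha⟩ := exists_eq_zero_of_lt hc.deriv
  obtain ⟨b, hb⟩ := hc.deriv.isCompact.bddAbove
  have hb' : ∀ x, b < x → deriv φ x = 0 := fun x hx =>
    image_eq_zero_of_notMem_tsupport fun h => (hb h).not_gt hx
  have hdi : Integrable fun s => ‖deriv φ s‖ := (hd.integrable_of_hasCompactSupport hc.deriv).norm
  set C := |1 / Real.Gamma (1 - α)| * ∫ s, ‖deriv φ s‖ with hC
  have hbound : ∀ t, b < t → ‖leftDeriv α φ t‖ ≤ C * (t - b) ^ (-α) := by
    intro t ht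
    rw [leftDeriv_eq_leftIntegral_deriv hα' hφ hc, leftIntegral_eq_convolution, Pi.smul_apply,
      convolution_lsmul_swap, norm_smul, Real.norm_eq_abs, hC, mul_assoc, ← integral_mul_const]
    refine mul_le_mul_of_nonneg_left ?_ (abs_nonneg _)
    refine norm_integral_le_of_norm_le (hdi.mul_const _) (Eventually.of_forall fun s => ?_)
    rcases lt_or_ge b s with h | h
    · simp [hb' s h]
    · rw [norm_smul, mul_comm, Real.norm_of_nonneg (kern_nonneg _ _),
        kern_of_pos (by linarith : 0 < t - s), show 1 - α - 1 = -α by ring]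
      exact mul_le_mul_of_nonneg_left (Real.rpow_le_rpow_of_nonpos (sub_pos.2 ht) (by linarith)
        (by linarith)) (norm_nonneg _)
  refine (memLp_two_iff_integrable_sq_norm hcont.aestronglyMeasurable).2 ?_
  have hcover : Set.Iio a ∪ (Set.Icc a (b + 1) ∪ Set.Ioi (b + 1)) = Set.univ := by
    ext x
    simp only [Set.mem_union, Set.mem_Iio, Set.mem_Icc, Set.mem_Ioi, Set.mem_univ, iff_true]
    by_cases h : x < a
    · exact Or.inl h
    · rcases le_or_gt x (b + 1) with h' | h'
      · exact Or.inr (Or.inl ⟨not_lt.1 h, h'⟩)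
      · exact Or.inr (Or.inr h')
  rw [← integrableOn_univ, ← hcover]
  refine IntegrableOn.union ?_ (IntegrableOn.union ?_ ?_)
  · refine IntegrableOn.congr_fun integrableOn_zero (fun x hx => ?_) measurableSet_Iio
    simp [leftDeriv_eq_zero hα' hφ hc ha hx]
  · exact (hcont.norm.pow 2).continuousOn.integrableOn_Icc
  · have hi : IntegrableOn (fun t => C ^ 2 * (t - b) ^ (2 * -α)) (Set.Ioi (b + 1)) := by
      refine Integrable.const_mul ?_ _
      have := (integrableOn_Ioi_rpow_of_lt (by linarith : 2 * -α < -1) zero_lt_one)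
      have h2 := (measurePreserving_sub_right (volume : Measure ℝ) b).integrableOn_comp_preimage
        (MeasurableEquiv.subRight b).measurableEmbedding (f := fun t : ℝ => t ^ (2 * -α))
        (s := Set.Ioi 1)
      have h3 : (fun x => x - b) ⁻¹' Set.Ioi 1 = Set.Ioi (b + 1) := by
        ext x
        simp only [Set.mem_preimage, Set.mem_Ioi]
        constructor <;> intro h <;> linarith
      rw [h3] at h2
      exact h2.2 this
    refine Integrable.mono' hi (hcont.norm.pow 2).aestronglyMeasurable ?_
    filter_upwards [ae_restrict_mem measurableSet_Ioi] with t ht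
    have ht' : b + 1 < t := ht
    rw [Real.norm_of_nonneg (sq_nonneg _)]
    have := pow_le_pow_left₀ (norm_nonneg _) (hbound t (by linarith)) 2
    rwa [mul_pow, ← Real.rpow_two ((t - b) ^ (-α)), ← Real.rpow_mul (by linarith),
      mul_comm (-α)] at this

theorem exists_ne_zero_mem_testGraph (hn : 1 ≤ n) (hα : 1 / 2 < α) (hα' : α < 1) :
    ∃ p ∈ testGraph n α, p.1 ≠ 0 := by
  let f : ContDiffBump (0 : ℝ) := ⟨1, 2, one_pos, one_lt_two⟩
  let x₀ : Vec n := EuclideanSpace.single ⟨0, hn⟩ 1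
  have hx₀ : x₀ ≠ 0 := by simp [x₀]
  let φ : ℝ → Vec n := fun t => f t • x₀
  have hφ : ContDiff ℝ ∞ φ := f.contDiff.smul contDiff_const
  have hc : HasCompactSupport φ := f.hasCompactSupport.smul_right
  have h1 : MemLp φ 2 := hφ.continuous.memLp_of_hasCompactSupport hc
  have h2 : MemLp (leftDeriv α φ) 2 := memLp_leftDeriv hα hα' (hφ.of_le (by simp)) hc
  refine ⟨(h1.toLp φ, h2.toLp _), ⟨φ, hφ, hc, h1.coeFn_toLp, h2.coeFn_toLp⟩, fun h0 => ?_⟩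
  have hae : φ =ᵐ[volume] fun _ => 0 :=
    h1.coeFn_toLp.symm.trans (by dsimp only at h0; rw [h0]; exact Lp.coeFn_zero _ _ _)
  have hz := (hφ.continuous.ae_eq_iff_eq volume continuous_const).1 hae
  have hz0 : f 0 • x₀ = 0 := congr_fun hz 0
  rw [f.one_of_mem_closedBall (Metric.mem_closedBall_self zero_le_one), one_smul] at hz0
  exact hx₀ hz0

end Nontrivial

/-! ### Coercivity of the form of `L`, and Fatou's lemma -/

section Coercivity

variable {n : ℕ} {L : ℝ → Matrix (Fin n) (Fin n) ℝ}

theorem CondL.exists_lower_bound (hL : CondL L) :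
    ∃ m : ℝ, 0 < m ∧ ∀ (t : ℝ) (x : Vec n), m * ‖x‖ ^ 2 ≤ inner ℝ (matVec (L t) x) x := by
  obtain ⟨l, hc, h0, hlim, h⟩ := hL.coercive
  obtain ⟨t₀, ht₀⟩ := hc.exists_forall_le hlim
  exact ⟨l t₀, h0 t₀, fun t x =>
    (mul_le_mul_of_nonneg_right (ht₀ t) (sq_nonneg _)).trans (h t x)⟩

theorem CondL.exists_lower_bound_at_infinity (hL : CondL L) (A : ℝ) :
    ∃ T : ℝ, ∀ t : ℝ, T ≤ |t| → ∀ x : Vec n, A * ‖x‖ ^ 2 ≤ inner ℝ (matVec (L t) x) x := by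
  obtain ⟨l, -, -, hlim, h⟩ := hL.coercive
  have h1 := hlim.eventually (eventually_ge_atTop A)
  rw [← Metric.cobounded_eq_cocompact, ← comap_norm_atTop, eventually_comap] at h1
  obtain ⟨T, hT⟩ := eventually_atTop.1 h1
  exact ⟨T, fun t ht x =>
    (mul_le_mul_of_nonneg_right (hT _ ht t rfl) (sq_nonneg _)).trans (h t x)⟩

theorem continuous_inner_matVec_self (M : Matrix (Fin n) (Fin n) ℝ) :
    Continuous fun x : Vec n => inner ℝ (matVec M x) x := by
  simp only [inner_matVec]
  fun_prop

/-- Fatou's lemma for the quadratic form of `L`. -/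
theorem integrable_form_of_ae_tendsto (hL : CondL L) {v : ℕ → L2 n} {w : L2 n}
    (hae : ∀ᵐ t, Tendsto (fun k => v k t) atTop (𝓝 (w t))) {c : ℝ}
    (hInt : ∀ k, Integrable fun t => inner ℝ (matVec (L t) (v k t)) (v k t))
    (hle : ∀ k, ∫ t, inner ℝ (matVec (L t) (v k t)) (v k t) ≤ c) :
    Integrable (fun t => inner ℝ (matVec (L t) (w t)) (w t)) ∧
      ∫ t, inner ℝ (matVec (L t) (w t)) (w t) ≤ c := by
  have hnn : ∀ z : L2 n, 0 ≤ᵐ[volume] fun t => inner ℝ (matVec (L t) (z t)) (z t) :=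
    fun z => Eventually.of_forall fun t => inner_matVec_nonneg hL t _
  have hbound : ∫⁻ t, ENNReal.ofReal (inner ℝ (matVec (L t) (w t)) (w t)) ≤ ENNReal.ofReal c := by
    calc ∫⁻ t, ENNReal.ofReal (inner ℝ (matVec (L t) (w t)) (w t))
        = ∫⁻ t, liminf (fun k => ENNReal.ofReal (inner ℝ (matVec (L t) (v k t)) (v k t)))
            atTop := by
          refine lintegral_congr_ae ?_
          filter_upwards [hae] with t ht
          exact (ENNReal.tendsto_ofReal
            (((continuous_inner_matVec_self (L t)).tendsto _).comp ht)).liminf_eq.symm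
      _ ≤ liminf (fun k => ∫⁻ t, ENNReal.ofReal (inner ℝ (matVec (L t) (v k t)) (v k t)))
            atTop := lintegral_liminf_le' fun k =>
              (aestronglyMeasurable_form hL _ _).aemeasurable.ennreal_ofReal
      _ ≤ ENNReal.ofReal c := by
          refine liminf_le_of_le (by isBoundedDefault) fun b hb => ?_
          obtain ⟨k, hk⟩ := hb.exists
          refine hk.trans ?_
          rw [← ofReal_integral_eq_lintegral_ofReal (hInt k) (hnn _)]
          exact ENNReal.ofReal_le_ofReal (hle k)
  have hc : 0 ≤ c := (integral_nonneg fun t => inner_matVec_nonneg hL t _).trans (hle 0)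
  have hi : Integrable fun t => inner ℝ (matVec (L t) (w t)) (w t) := by
    refine ⟨aestronglyMeasurable_form hL w w, ?_⟩
    rw [hasFiniteIntegral_iff_ofReal (hnn w)]
    exact hbound.trans_lt ENNReal.ofReal_lt_top
  refine ⟨hi, ?_⟩
  rw [← ofReal_integral_eq_lintegral_ofReal hi (hnn w)] at hbound
  exact (ENNReal.ofReal_le_ofReal_iff hc).1 hbound

end Coercivity

/-! ### Completeness, boundedness and decay in `X^α` -/

namespace XSpace

variable {n : ℕ} {α : ℝ} {L : ℝ → Matrix (Fin n) (Fin n) ℝ} {hL : CondL L}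

theorem inner_eq_form (u v : XSpace α hL) : inner ℝ u v = form u v := rfl

theorem fn_sub (u v : XSpace α hL) : (u - v).fn = u.fn - v.fn := rfl

theorem D_sub (u v : XSpace α hL) : (u - v).D = u.D - v.D := rfl

theorem norm_sq_eq (u : XSpace α hL) :
    ‖u‖ ^ 2 = ‖u.D‖ ^ 2 + ∫ t, inner ℝ (matVec (L t) (u.fn t)) (u.fn t) := by
  rw [← real_inner_self_eq_norm_sq, inner_eq_form, form,
    integral_add (integrable_D u u) (integrable_L u u), norm_sq_L2]
  simp only [real_inner_self_eq_norm_sq]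

theorem integral_form_le (u : XSpace α hL) :
    ∫ t, inner ℝ (matVec (L t) (u.fn t)) (u.fn t) ≤ ‖u‖ ^ 2 := by
  rw [norm_sq_eq]
  linarith [sq_nonneg ‖u.D‖]

theorem norm_D_le (u : XSpace α hL) : ‖u.D‖ ≤ ‖u‖ := by
  refine (sq_le_sq₀ (norm_nonneg _) (norm_nonneg _)).1 ?_
  rw [norm_sq_eq u]
  have : 0 ≤ ∫ t, inner ℝ (matVec (L t) (u.fn t)) (u.fn t) :=
    integral_nonneg fun t => inner_matVec_nonneg hL t _
  linarith

variable (α hL) in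
theorem exists_norm_fn_le :
    ∃ C : ℝ, 0 < C ∧ ∀ u : XSpace α hL, ‖u.fn‖ ≤ C * ‖u‖ := by
  obtain ⟨m, hm, h⟩ := hL.exists_lower_bound
  refine ⟨(√m)⁻¹, by positivity, fun u => ?_⟩
  have h1 : m * ‖u.fn‖ ^ 2 ≤ ‖u‖ ^ 2 := by
    refine le_trans ?_ (integral_form_le u)
    rw [norm_sq_L2, ← integral_const_mul]
    exact integral_mono ((integrable_norm_sq _).const_mul _) (integrable_L u u) fun t => h t _
  rw [inv_mul_eq_div, le_div_iff₀ (Real.sqrt_pos.2 hm)]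
  refine (sq_le_sq₀ (by positivity) (norm_nonneg _)).1 ?_
  rw [mul_pow, Real.sq_sqrt hm.le]
  linarith

/-- The embedding of `X^α` into `L²`. -/
def fnL : XSpace α hL →L[ℝ] L2 n :=
  LinearMap.mkContinuousOfExistsBound
    { toFun := fn, map_add' := fn_add, map_smul' := fn_smul }
    (let ⟨C, _, hC⟩ := exists_norm_fn_le α hL; ⟨C, hC⟩)

theorem fnL_apply (u : XSpace α hL) : fnL u = u.fn := rfl

instance completeSpace : CompleteSpace (XSpace α hL) := by
  refine Metric.complete_of_cauchySeq_tendsto fun u hu => ?_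
  have hDc : CauchySeq fun k => (u k).D := by
    refine Metric.cauchySeq_iff.2 fun ε hε => ?_
    obtain ⟨N, hN⟩ := Metric.cauchySeq_iff.1 hu ε hε
    refine ⟨N, fun k hk m hm => lt_of_le_of_lt ?_ (hN k hk m hm)⟩
    rw [dist_eq_norm, dist_eq_norm, ← D_sub]
    exact norm_D_le _
  obtain ⟨f, hf⟩ := cauchySeq_tendsto_of_complete
    ((fnL (α := α) (hL := hL)).uniformContinuous.comp_cauchySeq hu)
  obtain ⟨g, hg⟩ := cauchySeq_tendsto_of_complete hDc
  have hmem : (f, g) ∈ fracSobolev n α := by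
    refine (Submodule.isClosed_topologicalClosure _).mem_of_tendsto (hf.prodMk_nhds hg)
      (Eventually.of_forall fun k => (u k).2.1)
  obtain ⟨φ, hφ, hae⟩ := exists_subseq_ae_tendsto hf
  -- Fatou along `m ↦ u k - u (φ (m + N))`, where the shift by `N` keeps the second index in the
  -- Cauchy range. This shows both that `f` has finite form, being `u N` minus such a difference,
  -- and that the convergence holds in the norm of `X^α`.
  have key : ∀ ε : ℝ, 0 < ε → ∃ N, ∀ k ≥ N,
      Integrable (fun t => inner ℝ (matVec (L t) (((u k).fn - f) t)) (((u k).fn - f) t)) ∧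
      ∫ t, inner ℝ (matVec (L t) (((u k).fn - f) t)) (((u k).fn - f) t) ≤ ε ^ 2 := by
    intro ε hε
    obtain ⟨N, hN⟩ := Metric.cauchySeq_iff.1 hu ε hε
    refine ⟨N, fun k hk => integrable_form_of_ae_tendsto hL
      (v := fun m => (u k - u (φ (m + N))).fn) ?_ (fun m => (u k - u (φ (m + N))).2.2) fun m => ?_⟩
    · have hsub : ∀ᵐ t, ∀ m, (u k - u (φ (m + N))).fn t = (u k).fn t - (u (φ (m + N))).fn t :=
        ae_all_iff.2 fun m => Lp.coeFn_sub (u k).fn (u (φ (m + N))).fn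
      filter_upwards [hae, hsub, Lp.coeFn_sub (u k).fn f] with t ht h1 h2
      simp only [h1, h2, Pi.sub_apply]
      exact tendsto_const_nhds.sub (ht.comp (tendsto_add_atTop_nat N))
    · refine (integral_form_le _).trans ?_
      have h1 : N ≤ φ (m + N) := (Nat.le_add_left N m).trans (hφ.id_le _)
      have h2 := hN k hk _ h1
      rw [dist_eq_norm] at h2
      exact pow_le_pow_left₀ (norm_nonneg _) h2.le 2
  obtain ⟨N, hN⟩ := key 1 one_pos
  have hmemX : (f, g) ∈ xSubmodule α hL := by
    have h1 : (u N).1 - (f, g) ∈ xSubmodule α hL :=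
      ⟨Submodule.sub_mem _ (u N).2.1 hmem, (hN N le_rfl).1⟩
    simpa using Submodule.sub_mem _ (u N).2 h1
  let x : XSpace α hL := ⟨(f, g), hmemX⟩
  refine ⟨x, ?_⟩
  rw [tendsto_iff_norm_sub_tendsto_zero]
  have hsq : Tendsto (fun k => ‖u k - x‖ ^ 2) atTop (𝓝 0) := by
    have hD0 : Tendsto (fun k => ‖(u k - x).D‖ ^ 2) atTop (𝓝 0) := by
      have := (tendsto_iff_norm_sub_tendsto_zero.1 hg).pow 2
      rw [zero_pow two_ne_zero] at this
      exact this
    have hF0 : Tendsto (fun k => ∫ t, inner ℝ (matVec (L t) ((u k - x).fn t)) ((u k - x).fn t))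
        atTop (𝓝 0) := by
      rw [Metric.tendsto_atTop]
      intro ε hε
      obtain ⟨N, hN⟩ := key (√(ε / 2)) (Real.sqrt_pos.2 (half_pos hε))
      refine ⟨N, fun k hk => ?_⟩
      have h1 := (hN k hk).2
      rw [Real.sq_sqrt (half_pos hε).le] at h1
      rw [Real.dist_0_eq_abs, abs_of_nonneg (integral_nonneg fun t => inner_matVec_nonneg hL t _)]
      exact lt_of_le_of_lt h1 (half_lt_self hε)
    simp only [norm_sq_eq]
    simpa using hD0.add hF0
  have := hsq.sqrt
  simpa [Real.sqrt_sq (norm_nonneg _)] using this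

theorem ae_norm_sub_average_fn_le (hα : 1 / 2 < α) (hα' : α < 1) (u : XSpace α hL) {r : ℝ}
    (hr : 0 < r) :
    ∀ᵐ t, ‖u.fn t - average r u.fn t‖ ≤ holderConst α * r ^ (α - 1 / 2) * ‖u‖ := by
  filter_upwards [ae_norm_sub_average_le hα hα' u.2.1 hr] with t ht
  refine ht.trans (mul_le_mul_of_nonneg_left (norm_D_le u) ?_)
  exact mul_nonneg (holderConst_nonneg (by linarith)) (Real.rpow_nonneg hr.le _)

/-- `X^α` embeds into `L^∞`. -/
theorem exists_ae_norm_le (hα : 1 / 2 < α) (hα' : α < 1) (hL : CondL L) :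
    ∃ C : ℝ, 0 < C ∧ ∀ u : XSpace α hL, ∀ᵐ t, ‖u.fn t‖ ≤ C * ‖u‖ := by
  obtain ⟨C, hC, h⟩ := exists_norm_fn_le α hL
  have hH : 0 ≤ holderConst α := holderConst_nonneg (by linarith)
  refine ⟨holderConst α + C, by linarith, fun u => ?_⟩
  filter_upwards [ae_norm_sub_average_fn_le hα hα' u one_pos] with t ht
  have h1 := norm_average_le_norm one_pos u.fn t
  simp only [inv_one, Real.sqrt_one, one_mul, Real.one_rpow, mul_one] at h1 ht
  have h2 := norm_le_norm_sub_add (u.fn t) (average 1 u.fn t)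
  have h3 := h u
  linarith

/-- Elements of a bounded subset of `X^α` decay uniformly at infinity. -/
theorem exists_uniform_decay (hα : 1 / 2 < α) (hα' : α < 1) (hL : CondL L) (M : ℝ) {δ : ℝ}
    (hδ : 0 < δ) :
    ∃ T : ℝ, ∀ u : XSpace α hL, ‖u‖ ≤ M → ∀ᵐ t, T ≤ |t| → ‖u.fn t‖ ≤ δ := by
  have hH : 0 ≤ holderConst α := holderConst_nonneg (by linarith)
  have hexp : 0 < α - 1 / 2 := by linarith
  obtain ⟨r, hr, hrδ⟩ : ∃ r : ℝ, 0 < r ∧ holderConst α * r ^ (α - 1 / 2) * M ≤ δ / 2 := by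
    have hlim : Tendsto (fun r : ℝ => holderConst α * r ^ (α - 1 / 2) * M) (𝓝[>] 0)
        (𝓝 (holderConst α * 0 ^ (α - 1 / 2) * M)) :=
      ((((Real.continuousAt_rpow_const 0 _ (Or.inr hexp.le)).tendsto).const_mul _).mul_const
        M).mono_left nhdsWithin_le_nhds
    rw [Real.zero_rpow hexp.ne', mul_zero, zero_mul] at hlim
    obtain ⟨r, h1, h2⟩ := ((hlim.eventually (ge_mem_nhds (half_pos hδ))).and
      self_mem_nhdsWithin).exists
    exact ⟨r, h2, h1⟩
  -- Chosen so that `L ≥ A` on the window forces the average below `δ / 2`; the `+ 1` keeps `A`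
  -- positive when `M = 0`.
  set A : ℝ := r⁻¹ * (M ^ 2 + 1) / (δ / 2) ^ 2 with hA
  have hApos : 0 < A := by positivity
  obtain ⟨T, hT⟩ := hL.exists_lower_bound_at_infinity A
  -- With `T + r ≤ |t|` the whole window `(t, t + r]` lies in `T ≤ |s|`.
  refine ⟨T + r, fun u hu => ?_⟩
  filter_upwards [ae_norm_sub_average_fn_le hα hα' u hr] with t ht htT
  have hM : 0 ≤ M := (norm_nonneg _).trans hu
  have h1 : A * ∫ s in Set.Ioc t (t + r), ‖u.fn s‖ ^ 2 ≤ M ^ 2 := by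
    calc A * ∫ s in Set.Ioc t (t + r), ‖u.fn s‖ ^ 2
        = ∫ s in Set.Ioc t (t + r), A * ‖u.fn s‖ ^ 2 := (integral_const_mul _ _).symm
      _ ≤ ∫ s in Set.Ioc t (t + r), inner ℝ (matVec (L s) (u.fn s)) (u.fn s) := by
          refine setIntegral_mono_on ((integrable_norm_sq _).const_mul _).integrableOn
            (integrable_L u u).integrableOn measurableSet_Ioc fun s hs => hT s ?_ _
          have h2 : |t| ≤ |s| + |t - s| := by
            simpa using abs_add_le s (t - s)
          have h3 : |t - s| ≤ r := by
            rw [abs_le]; constructor <;> linarith [hs.1, hs.2]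
          linarith
      _ ≤ ∫ s, inner ℝ (matVec (L s) (u.fn s)) (u.fn s) :=
          setIntegral_le_integral (integrable_L u u)
            (Eventually.of_forall fun s => inner_matVec_nonneg hL s _)
      _ ≤ ‖u‖ ^ 2 := integral_form_le u
      _ ≤ M ^ 2 := pow_le_pow_left₀ (norm_nonneg _) hu 2
  have h2 : r⁻¹ * ∫ s in Set.Ioc t (t + r), ‖u.fn s‖ ^ 2 ≤ (δ / 2) ^ 2 := by
    have h3 : ∫ s in Set.Ioc t (t + r), ‖u.fn s‖ ^ 2 ≤ (M ^ 2 + 1) / A := by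
      rw [le_div_iff₀ hApos]
      linarith
    have h4 : (M ^ 2 + 1) / A = r * (δ / 2) ^ 2 := by
      rw [hA]; field_simp
    rw [inv_mul_le_iff₀ hr]
    linarith
  have h3 : ‖average r u.fn t‖ ≤ δ / 2 := by
    refine (norm_average_le hr u.fn t).trans ?_
    rw [← Real.sqrt_sq (half_pos hδ).le]
    exact Real.sqrt_le_sqrt h2
  have h4 := norm_le_norm_sub_add (u.fn t) (average r u.fn t)
  have h5 : holderConst α * r ^ (α - 1 / 2) * ‖u‖ ≤ holderConst α * r ^ (α - 1 / 2) * M :=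
    mul_le_mul_of_nonneg_left hu (mul_nonneg hH (Real.rpow_nonneg hr.le _))
  linarith

end XSpace

/-! ### Almost everywhere convergent subsequences -/

section Compactness

variable {n : ℕ} {α : ℝ} {L : ℝ → Matrix (Fin n) (Fin n) ℝ} {hL : CondL L}

/-- A bounded sequence of `L²` has a subsequence along which all averages converge. -/
theorem exists_subseq_tendsto_average {u : ℕ → L2 n} {M : ℝ} (hu : ∀ k, ‖u k‖ ≤ M) :
    ∃ φ : ℕ → ℕ, StrictMono φ ∧ ∀ r t : ℝ, ∃ x, Tendsto (fun k => average r (u (φ k)) t)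
      atTop (𝓝 x) := by
  have : Fact ((2 : ENNReal) ≠ ⊤) := ⟨by norm_num⟩
  have hmem : ∀ k, StrongDual.toWeakDual (InnerProductSpace.toDual ℝ (L2 n) (u k)) ∈
      (WeakDual.toStrongDual ⁻¹' Metric.closedBall (0 : StrongDual ℝ (L2 n)) M) := by
    intro k
    simpa using hu k
  obtain ⟨a, -, φ, hφ, ha⟩ := WeakDual.isSeqCompact_closedBall ℝ (L2 n) 0 M hmem
  have hw : ∀ w : L2 n, Tendsto (fun k => inner ℝ w (u (φ k))) atTop (𝓝 (a w)) := by
    intro w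
    have := ((WeakDual.eval_continuous w).tendsto a).comp ha
    refine this.congr fun k => ?_
    exact real_inner_comm w (u (φ k))
  refine ⟨φ, hφ, fun r t => ?_⟩
  let S := Set.Ioc t (t + r)
  have hS : (volume : Measure ℝ) S ≠ ⊤ := measure_Ioc_lt_top.ne
  -- The coordinates of the integral over `S` are inner products with the functions `1_S e_i`, so a
  -- weakly convergent subsequence serves all `r` and `t` at once.
  refine ⟨r⁻¹ • WithLp.toLp 2 fun i => a (indicatorConstLp 2 measurableSet_Ioc hS
    (EuclideanSpace.single i 1)), Tendsto.const_smul ?_ _⟩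
  have hpi : Tendsto (fun k => WithLp.ofLp (∫ s in S, u (φ k) s)) atTop (𝓝 fun i =>
      a (indicatorConstLp 2 measurableSet_Ioc hS (EuclideanSpace.single i 1))) := by
    refine tendsto_pi_nhds.2 fun i => ?_
    refine (hw _).congr fun k => ?_
    rw [L2.inner_indicatorConstLp_eq_inner_setIntegral, EuclideanSpace.inner_single_left]
    simp [S]
  exact ((PiLp.continuous_toLp 2 _).tendsto _).comp hpi

/-- A bounded sequence of `X^α` has an almost everywhere convergent subsequence. -/
theorem XSpace.exists_subseq_ae_tendsto_of_bounded (hα : 1 / 2 < α) (hα' : α < 1)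
    {u : ℕ → XSpace α hL} {M : ℝ} (hu : ∀ k, ‖u k‖ ≤ M) :
    ∃ φ : ℕ → ℕ, StrictMono φ ∧
      ∀ᵐ t, ∃ x, Tendsto (fun k => (u (φ k)).fn t) atTop (𝓝 x) := by
  obtain ⟨C, hC, hfn⟩ := exists_norm_fn_le α hL
  have hH : 0 ≤ holderConst α := holderConst_nonneg (by linarith)
  have hexp : 0 < α - 1 / 2 := by linarith
  obtain ⟨φ, hφ, hav⟩ := exists_subseq_tendsto_average (u := fun k => (u k).fn) (M := C * M)
    fun k => (hfn _).trans (mul_le_mul_of_nonneg_left (hu k) hC.le)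
  refine ⟨φ, hφ, ?_⟩
  let r : ℕ → ℝ := fun j => 1 / ((j : ℝ) + 1)
  have hr : ∀ j, 0 < r j := fun j => by positivity
  have hlim : Tendsto (fun j => holderConst α * r j ^ (α - 1 / 2) * M) atTop (𝓝 0) := by
    have h1 : Tendsto (fun j => r j ^ (α - 1 / 2)) atTop (𝓝 (0 ^ (α - 1 / 2))) :=
      ((Real.continuousAt_rpow_const 0 _ (Or.inr hexp.le)).tendsto).comp
        tendsto_one_div_add_atTop_nhds_zero_nat
    rw [Real.zero_rpow hexp.ne'] at h1
    simpa using (h1.const_mul (holderConst α)).mul_const M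
  filter_upwards [ae_all_iff.2 fun k => ae_all_iff.2 fun j =>
    ae_norm_sub_average_fn_le hα hα' (u k) (hr j)] with t ht
  refine cauchySeq_tendsto_of_complete (Metric.cauchySeq_iff'.2 fun ε hε => ?_)
  -- A width `r j` is fixed for which every `u k` is within `ε/3` of its average, uniformly in `k`;
  -- at this width the averages converge.
  obtain ⟨j, hj⟩ := (hlim.eventually (gt_mem_nhds (show 0 < ε / 3 by positivity))).exists
  obtain ⟨x, hx⟩ := hav (r j) t
  obtain ⟨N, hN⟩ := Metric.cauchySeq_iff'.1 hx.cauchySeq (ε / 3) (by positivity)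
  refine ⟨N, fun k hk => ?_⟩
  have h1 : ∀ k, dist ((u k).fn t) (average (r j) (u k).fn t) < ε / 3 := by
    intro k
    rw [dist_eq_norm]
    refine lt_of_le_of_lt ((ht k j).trans ?_) hj
    exact mul_le_mul_of_nonneg_left (hu k) (mul_nonneg hH (Real.rpow_nonneg (hr j).le _))
  have h2 := hN k hk
  have h3 := dist_triangle4 ((u (φ k)).fn t) (average (r j) (u (φ k)).fn t)
    (average (r j) (u (φ N)).fn t) ((u (φ N)).fn t)
  have h4 := h1 (φ k)
  have h5 := h1 (φ N)
  rw [dist_comm] at h5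
  linarith

end Compactness

/-- A continuous Gateaux derivative is a Fréchet derivative. -/
theorem hasFDerivAt_of_hasDerivAt_line {E : Type*} [NormedAddCommGroup E] [NormedSpace ℝ E]
    {f : E → ℝ} {f' : E → E →L[ℝ] ℝ}
    (hf : ∀ u v, HasDerivAt (fun s : ℝ => f (u + s • v)) (f' u v) 0) (hf' : Continuous f')
    (u : E) : HasFDerivAt f (f' u) u := by
  have hline : ∀ (v : E) (s : ℝ), HasDerivAt (fun s : ℝ => f (u + s • v)) (f' (u + s • v) v) s := by
    intro v s
    have h1 := hf (u + s • v) v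
    rw [← sub_self s] at h1
    have h2 := HasDerivAt.comp_sub_const s s h1
    refine h2.congr_of_eventuallyEq (Eventually.of_forall fun x => ?_)
    simp only [add_assoc, ← add_smul, add_sub_cancel]
  rw [hasFDerivAt_iff_isLittleO_nhds_zero, Asymptotics.isLittleO_iff]
  intro c hc
  obtain ⟨δ, hδ, h⟩ := Metric.continuousAt_iff.1 (hf'.continuousAt (x := u)) c hc
  filter_upwards [Metric.ball_mem_nhds (0 : E) hδ] with v hv
  rw [mem_ball_zero_iff] at hv
  have hd : ∀ s : ℝ, HasDerivAt (fun s : ℝ => f (u + s • v) - s * f' u v)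
      (f' (u + s • v) v - f' u v) s := fun s => by
    have h1 := (hline v s).sub ((hasDerivAt_id s).mul_const (f' u v))
    rwa [one_mul] at h1
  -- Mean value inequality on `[0, 1]` for `s ↦ f (u + s • v) - s * f' u v`, whose derivative is
  -- small by continuity of `f'` at `u`.
  have := norm_image_sub_le_of_norm_deriv_le_segment_01' (C := c * ‖v‖)
    (fun s _ => (hd s).hasDerivWithinAt) fun s hs => ?_
  · simpa [sub_right_comm] using this
  · rw [← sub_apply]
    refine (ContinuousLinearMap.le_opNorm _ _).trans
      (mul_le_mul_of_nonneg_right ?_ (norm_nonneg _))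
    rw [← dist_eq_norm]
    refine (h ?_).le
    rw [dist_self_add_left, norm_smul, Real.norm_of_nonneg hs.1]
    exact lt_of_le_of_lt (mul_le_of_le_one_left (norm_nonneg _) hs.2.le) hv

/-! ### Pointwise properties of the potential -/

section Potential

variable {n : ℕ} {W : ℝ → Vec n → ℝ}

theorem hasFDerivAt_potential (hW : ContDiff ℝ 1 fun p : ℝ × Vec n => W p.1 p.2) (t : ℝ)
    (x : Vec n) : HasFDerivAt (W t)
      ((fderiv ℝ (fun p : ℝ × Vec n => W p.1 p.2) (t, x)).comp
        (ContinuousLinearMap.inr ℝ ℝ (Vec n))) x :=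
  ((hW.differentiable one_ne_zero (t, x)).hasFDerivAt).comp x (hasFDerivAt_prodMk_right t x)

theorem hasGradientAt_potential (hW : ContDiff ℝ 1 fun p : ℝ × Vec n => W p.1 p.2) (t : ℝ)
    (x : Vec n) : HasGradientAt (W t) (gradient (W t) x) x :=
  (hasFDerivAt_potential hW t x).differentiableAt.hasGradientAt

theorem continuous_gradient_potential (hW : ContDiff ℝ 1 fun p : ℝ × Vec n => W p.1 p.2) :
    Continuous fun p : ℝ × Vec n => gradient (W p.1) p.2 := by
  have h : ∀ p : ℝ × Vec n, gradient (W p.1) p.2 = (InnerProductSpace.toDual ℝ (Vec n)).symm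
      ((fderiv ℝ (fun p : ℝ × Vec n => W p.1 p.2) p).comp
        (ContinuousLinearMap.inr ℝ ℝ (Vec n))) := fun p => by
    rw [gradient, (hasFDerivAt_potential hW p.1 p.2).fderiv]
  simp only [h]
  exact (LinearIsometryEquiv.continuous _).comp
    ((hW.continuous_fderiv one_ne_zero).clm_comp continuous_const)

theorem hasDerivAt_potential_line (hW : ContDiff ℝ 1 fun p : ℝ × Vec n => W p.1 p.2) (t : ℝ)
    (x y : Vec n) (s : ℝ) :
    HasDerivAt (fun s : ℝ => W t (x + s • y)) (inner ℝ (gradient (W t) (x + s • y)) y) s := by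
  have h1 : HasDerivAt (fun s : ℝ => x + s • y) y s := by
    simpa using ((hasDerivAt_id s).smul_const y).const_add x
  have h2 := (hasGradientAt_potential hW t (x + s • y)).hasFDerivAt.comp_hasDerivAt s h1
  rwa [InnerProductSpace.toDual_apply_apply] at h2

/-- The Ambrosetti–Rabinowitz condition extends to `x = 0`. -/
theorem CondW1.exists_superquadratic (hn : 1 ≤ n) (hW1 : CondW1 W) :
    ∃ μ : ℝ, 2 < μ ∧ ∀ t, W t 0 = 0 ∧ ∀ x, 0 ≤ W t x ∧
      μ * W t x ≤ inner ℝ x (gradient (W t) x) := by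
  obtain ⟨hW, μ, hμ, h⟩ := hW1
  refine ⟨μ, hμ, fun t => ?_⟩
  have : Nonempty (Fin n) := ⟨⟨0, hn⟩⟩
  have : Nontrivial (Vec n) := inferInstance
  have : (𝓝[≠] (0 : Vec n)).NeBot := Module.punctured_nhds_neBot ℝ (Vec n) 0
  have hc : Continuous (W t) := hW.continuous.comp (Continuous.prodMk_right t)
  have hcg : Continuous fun x => gradient (W t) x :=
    (continuous_gradient_potential hW).comp (Continuous.prodMk_right t)
  have hne : ∀ᶠ x in 𝓝[≠] (0 : Vec n), x ≠ 0 := self_mem_nhdsWithin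
  have h1 : 0 ≤ W t 0 := by
    refine ge_of_tendsto (hc.continuousAt.mono_left nhdsWithin_le_nhds) (hne.mono fun x hx => ?_)
    exact (pos_of_mul_pos_right (h t x hx).1 (by linarith)).le
  have h2 : μ * W t 0 ≤ inner ℝ (0 : Vec n) (gradient (W t) 0) :=
    le_of_tendsto_of_tendsto
      ((continuous_const.mul hc).continuousAt.mono_left nhdsWithin_le_nhds)
      ((continuous_id.inner hcg).continuousAt.mono_left nhdsWithin_le_nhds)
      (hne.mono fun x hx => (h t x hx).2)
  have h0 : W t 0 = 0 := by
    rw [inner_zero_left] at h2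
    nlinarith
  refine ⟨h0, fun x => ?_⟩
  by_cases hx : x = 0
  · simp [hx, h0]
  · exact ⟨(pos_of_mul_pos_right (h t x hx).1 (by linarith)).le, (h t x hx).2⟩

theorem potential_le (hn : 1 ≤ n) (hW1 : CondW1 W) (t : ℝ) (x : Vec n) :
    |W t x| ≤ ‖x‖ * ‖gradient (W t) x‖ := by
  obtain ⟨μ, hμ, h⟩ := hW1.exists_superquadratic hn
  have h1 := (h t).2 x
  rw [abs_of_nonneg h1.1]
  refine le_trans ?_ (h1.2.trans (real_inner_le_norm _ _))
  nlinarith [h1.1]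

/-- Superquadratic growth along rays. -/
theorem rpow_mul_potential_le (hW : ContDiff ℝ 1 fun p : ℝ × Vec n => W p.1 p.2) {μ : ℝ}
    (t : ℝ) (h : ∀ x, μ * W t x ≤ inner ℝ x (gradient (W t) x)) (x : Vec n) {s : ℝ}
    (hs : 1 ≤ s) : s ^ μ * W t x ≤ W t (s • x) := by
  have hd : ∀ r : ℝ, 0 < r → HasDerivAt (fun r : ℝ => r ^ (-μ) * W t (r • x))
      (-μ * r ^ (-μ - 1) * W t (r • x) +
        r ^ (-μ) * inner ℝ (gradient (W t) (r • x)) x) r := by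
    intro r hr
    have h1 := hasDerivAt_potential_line hW t 0 x r
    simp only [zero_add] at h1
    exact (Real.hasDerivAt_rpow_const (Or.inl hr.ne')).mul h1
  -- Condition (W₁) says exactly that `r^(-μ) W(t, r x)` has nonnegative derivative in `r > 0`.
  have hmono : MonotoneOn (fun r : ℝ => r ^ (-μ) * W t (r • x)) (Set.Ici 1) := by
    refine monotoneOn_of_hasDerivWithinAt_nonneg (convex_Ici 1)
      (fun r hr => (hd r (zero_lt_one.trans_le hr)).continuousAt.continuousWithinAt)
      (fun r hr => (hd r (zero_lt_one.trans (by simpa using hr))).hasDerivWithinAt) fun r hr => ?_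
    have hr0 : 0 < r := zero_lt_one.trans (by simpa using hr)
    have h2 := h (r • x)
    rw [real_inner_comm, inner_smul_right] at h2
    have h3 : r ^ (-μ) = r ^ (-μ - 1) * r := by
      rw [← Real.rpow_add_one hr0.ne', sub_add_cancel]
    have h4 : -μ * r ^ (-μ - 1) * W t (r • x) + r ^ (-μ) * inner ℝ (gradient (W t) (r • x)) x =
        r ^ (-μ - 1) * (r * inner ℝ (gradient (W t) (r • x)) x - μ * W t (r • x)) := by
      rw [h3]; ring
    rw [h4]
    exact mul_nonneg (Real.rpow_nonneg hr0.le _) (by linarith)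
  have hs0 : 0 < s := zero_lt_one.trans_le hs
  have h5 := hmono (Set.mem_Ici.2 le_rfl) (Set.mem_Ici.2 hs) hs
  simp only [Real.one_rpow, one_mul, one_smul, Real.rpow_neg hs0.le] at h5
  rwa [le_inv_mul_iff₀ (Real.rpow_pos_of_pos hs0 _)] at h5

/-- For `‖x‖ < δ` this is (W₂) with `ε = 1`. The remaining points lie in the compact set `|t| ≤ T`,
`‖x‖ ≤ R`, where the gradient has a bound `B`, and `B ≤ (B / δ) ‖x‖` since `‖x‖ ≥ δ`. -/
theorem exists_linear_growth (hW : ContDiff ℝ 1 fun p : ℝ × Vec n => W p.1 p.2)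
    (hW2 : CondW2 W) :
    ∃ δ : ℝ, 0 < δ ∧ ∀ R T : ℝ, ∃ C : ℝ, 0 < C ∧ ∀ (t : ℝ) (x : Vec n), ‖x‖ ≤ R →
      (T ≤ |t| → ‖x‖ < δ) → ‖gradient (W t) x‖ ≤ C * ‖x‖ := by
  obtain ⟨δ, hδ, h⟩ := hW2 1 one_pos
  refine ⟨δ, hδ, fun R T => ?_⟩
  obtain ⟨B, hB⟩ := ((isCompact_Icc (a := -T) (b := T)).prod
    (isCompact_closedBall (0 : Vec n) R)).exists_bound_of_continuousOn
    (continuous_gradient_potential hW).continuousOn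
  refine ⟨max 1 (B / δ), by positivity, fun t x hx ht => ?_⟩
  rcases lt_or_ge ‖x‖ δ with hxδ | hxδ
  · exact (h t x hxδ).trans (mul_le_mul_of_nonneg_right (le_max_left _ _) (norm_nonneg _))
  · have htT : |t| < T := by
      by_contra! h'
      exact hxδ.not_gt (ht h')
    have hBtx : ‖gradient (W t) x‖ ≤ B :=
      hB (t, x) ⟨abs_le.1 htT.le, by simpa using hx⟩
    have hB0 : 0 ≤ B := (norm_nonneg _).trans hBtx
    calc ‖gradient (W t) x‖ ≤ B := hBtx
      _ = B / δ * δ := by field_simp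
      _ ≤ B / δ * ‖x‖ := mul_le_mul_of_nonneg_left hxδ (by positivity)
      _ ≤ max 1 (B / δ) * ‖x‖ := mul_le_mul_of_nonneg_right (le_max_right _ _) (norm_nonneg _)

end Potential

/-! ### The superposition operator `u ↦ ∇W(·, u)` -/

section Nemytskii

variable {n : ℕ} {α : ℝ} {L : ℝ → Matrix (Fin n) (Fin n) ℝ} {hL : CondL L}
  {W : ℝ → Vec n → ℝ}

/-- The `L^∞` bound and the uniform decay place `(t, x)` in the scope of `exists_linear_growth`. The
factor `2` leaves room for the points `u + s v`, `|s| ≤ 1`, met when differentiating the energy. -/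
theorem exists_gradient_bound (hα : 1 / 2 < α) (hα' : α < 1) (hL : CondL L)
    (hW : ContDiff ℝ 1 fun p : ℝ × Vec n => W p.1 p.2) (hW2 : CondW2 W) (M : ℝ) :
    ∃ C : ℝ, 0 < C ∧ ∀ u : XSpace α hL, ‖u‖ ≤ M → ∀ᵐ t, ∀ x, ‖x‖ ≤ 2 * ‖u.fn t‖ →
      ‖gradient (W t) x‖ ≤ C * ‖x‖ := by
  obtain ⟨δ, hδ, hlin⟩ := exists_linear_growth hW hW2
  obtain ⟨K, hK, hsup⟩ := XSpace.exists_ae_norm_le hα hα' hL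
  obtain ⟨T, hT⟩ := XSpace.exists_uniform_decay hα hα' hL M (show 0 < δ / 4 by positivity)
  obtain ⟨C, hC, h⟩ := hlin (2 * (K * M)) T
  refine ⟨C, hC, fun u hu => ?_⟩
  filter_upwards [hsup u, hT u hu] with t h1 h2 x hx
  refine h t x ?_ fun ht => ?_
  · have := mul_le_mul_of_nonneg_left hu hK.le
    linarith
  · linarith [h2 ht]

theorem aestronglyMeasurable_gradient (hW : ContDiff ℝ 1 fun p : ℝ × Vec n => W p.1 p.2)
    {f : ℝ → Vec n} (hf : AEStronglyMeasurable f) :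
    AEStronglyMeasurable fun t => gradient (W t) (f t) :=
  (continuous_gradient_potential hW).comp_aestronglyMeasurable
    (aestronglyMeasurable_id.prodMk hf)

theorem memLp_gradient (hα : 1 / 2 < α) (hα' : α < 1)
    (hW : ContDiff ℝ 1 fun p : ℝ × Vec n => W p.1 p.2) (hW2 : CondW2 W) (u : XSpace α hL) :
    MemLp (fun t => gradient (W t) (u.fn t)) 2 := by
  obtain ⟨C, -, h⟩ := exists_gradient_bound hα hα' hL hW hW2 ‖u‖
  refine (Lp.memLp u.fn).of_le_mul (c := C)
    (aestronglyMeasurable_gradient hW (Lp.aestronglyMeasurable _)) ?_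
  filter_upwards [h u le_rfl] with t ht
  exact ht _ (by linarith [norm_nonneg (u.fn t)])

open Classical in
/-- The superposition operator `u ↦ ∇W(·, u(·))` from `X^α` to `L²`. -/
def nemytskii (W : ℝ → Vec n → ℝ) (u : XSpace α hL) : L2 n :=
  if h : MemLp (fun t => gradient (W t) (u.fn t)) 2 then h.toLp else 0

/-- Under the hypotheses the default value `0` of `nemytskii` is never taken. -/
theorem coeFn_nemytskii (hα : 1 / 2 < α) (hα' : α < 1)
    (hW : ContDiff ℝ 1 fun p : ℝ × Vec n => W p.1 p.2) (hW2 : CondW2 W) (u : XSpace α hL) :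
    nemytskii W u =ᵐ[volume] fun t => gradient (W t) (u.fn t) := by
  rw [nemytskii, dif_pos (memLp_gradient hα hα' hW hW2 u)]
  exact MemLp.coeFn_toLp _

theorem integrable_potential (hn : 1 ≤ n) (hα : 1 / 2 < α) (hα' : α < 1) (hW1 : CondW1 W)
    (hW2 : CondW2 W) (u : XSpace α hL) : Integrable fun t => W t (u.fn t) := by
  have hW := hW1.1
  refine ((Lp.memLp u.fn).norm.integrable_mul (memLp_gradient hα hα' hW hW2 u).norm).mono'
    (hW.continuous.comp_aestronglyMeasurable
      (aestronglyMeasurable_id.prodMk (Lp.aestronglyMeasurable _)))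
    (Eventually.of_forall fun t => potential_le hn hW1 t _)

/-- The superposition operator maps bounded, almost everywhere convergent sequences of `X^α` to
Cauchy sequences of `L²`. -/
theorem cauchySeq_nemytskii (hα : 1 / 2 < α) (hα' : α < 1)
    (hW : ContDiff ℝ 1 fun p : ℝ × Vec n => W p.1 p.2) (hW2 : CondW2 W) {u : ℕ → XSpace α hL}
    {M : ℝ} (hu : ∀ k, ‖u k‖ ≤ M)
    (hae : ∀ᵐ t, ∃ x, Tendsto (fun k => (u k).fn t) atTop (𝓝 x)) :
    CauchySeq fun k => nemytskii W (u k) := by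
  obtain ⟨K, hK, hsup⟩ := XSpace.exists_ae_norm_le hα hα' hL
  obtain ⟨C, hC, hfn⟩ := XSpace.exists_norm_fn_le α hL
  obtain ⟨B, hB, hgrad⟩ := exists_gradient_bound hα hα' hL hW hW2 M
  have hM : 0 ≤ M := (norm_nonneg _).trans (hu 0)
  have hN := ae_all_iff.2 fun k => coeFn_nemytskii hα hα' hW hW2 (u k)
  have hbd : ∀ᵐ t, ∀ k, ‖nemytskii W (u k) t‖ ≤ B * (K * M) := by
    filter_upwards [hN, ae_all_iff.2 fun k => hsup (u k),
      ae_all_iff.2 fun k => hgrad (u k) (hu k)] with t h1 h2 h3 k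
    rw [h1]
    refine (h3 k _ (by linarith [norm_nonneg ((u k).fn t)])).trans
      (mul_le_mul_of_nonneg_left ((h2 k).trans ?_) hB.le)
    exact mul_le_mul_of_nonneg_left (hu k) hK.le
  have hmeas : ∀ p : ℕ × ℕ, AEStronglyMeasurable
      (fun t => ‖nemytskii W (u p.1) t - nemytskii W (u p.2) t‖ ^ 2) volume := fun p =>
    (((Lp.aestronglyMeasurable _).sub (Lp.aestronglyMeasurable _)).norm.pow 2)
  have hInt : ∀ p : ℕ × ℕ, Integrable
      (fun t => ‖nemytskii W (u p.1) t - nemytskii W (u p.2) t‖ ^ 2) := fun p =>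
    (memLp_two_iff_integrable_sq_norm ((Lp.aestronglyMeasurable _).sub
      (Lp.aestronglyMeasurable _))).1 ((Lp.memLp _).sub (Lp.memLp _))
  -- On a bounded interval the uniform bound allows dominated convergence.
  have hlocal : ∀ T : ℝ, Tendsto (fun p : ℕ × ℕ => ∫ t in Set.Icc (-T) T,
      ‖nemytskii W (u p.1) t - nemytskii W (u p.2) t‖ ^ 2) atTop (𝓝 0) := by
    intro T
    have := tendsto_integral_filter_of_dominated_convergence
      (μ := volume.restrict (Set.Icc (-T) T)) (l := (atTop : Filter (ℕ × ℕ)))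
      (F := fun p t => ‖nemytskii W (u p.1) t - nemytskii W (u p.2) t‖ ^ 2)
      (f := fun _ => 0) (fun _ => (2 * (B * (K * M))) ^ 2)
      (Eventually.of_forall fun p => (hmeas p).restrict)
      (Eventually.of_forall fun p => ae_restrict_of_ae ?_) (integrable_const _)
      (ae_restrict_of_ae ?_)
    · simpa using this
    · filter_upwards [hbd] with t ht
      rw [Real.norm_of_nonneg (sq_nonneg _)]
      refine pow_le_pow_left₀ (norm_nonneg _) ((norm_sub_le _ _).trans ?_) 2
      linarith [ht p.1, ht p.2]
    · filter_upwards [hae, hN] with t ⟨x, hx⟩ h1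
      have hconv : Tendsto (fun k => nemytskii W (u k) t) atTop (𝓝 (gradient (W t) x)) := by
        simp only [h1]
        exact (((continuous_gradient_potential hW).comp
          (Continuous.prodMk_right t)).tendsto x).comp hx
      have := cauchySeq_iff_tendsto_dist_atTop_0.1 hconv.cauchySeq
      simp only [dist_eq_norm] at this
      simpa using this.pow 2
  -- Far out all `u k` are uniformly small, so (W₂) gives `‖∇W(t, u k)‖ ≤ ε ‖u k‖`, and the `L²`
  -- norms are bounded by `C M`.
  have htail : ∀ ε : ℝ, 0 < ε → ∃ T : ℝ, ∀ p : ℕ × ℕ, ∫ t in (Set.Icc (-T) T)ᶜ,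
      ‖nemytskii W (u p.1) t - nemytskii W (u p.2) t‖ ^ 2 ≤ 4 * ε ^ 2 * (C * M) ^ 2 := by
    intro ε hε
    obtain ⟨δ, hδ, hW2'⟩ := hW2 ε hε
    obtain ⟨T, hT⟩ := XSpace.exists_uniform_decay hα hα' hL M (half_pos hδ)
    refine ⟨T, fun p => ?_⟩
    have hle : ∀ k, ∫ t, ‖(u k).fn t‖ ^ 2 ≤ (C * M) ^ 2 := fun k => by
      rw [← norm_sq_L2]
      exact pow_le_pow_left₀ (norm_nonneg _)
        ((hfn _).trans (mul_le_mul_of_nonneg_left (hu k) hC.le)) 2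
    have hi : ∀ k, Integrable fun t => 2 * ε ^ 2 * ‖(u k).fn t‖ ^ 2 := fun k =>
      (integrable_norm_sq _).const_mul _
    calc ∫ t in (Set.Icc (-T) T)ᶜ, ‖nemytskii W (u p.1) t - nemytskii W (u p.2) t‖ ^ 2
        ≤ ∫ t in (Set.Icc (-T) T)ᶜ, (2 * ε ^ 2 * ‖(u p.1).fn t‖ ^ 2 +
            2 * ε ^ 2 * ‖(u p.2).fn t‖ ^ 2) := by
          refine setIntegral_mono_on_ae (hInt p).integrableOn
            ((hi _).add (hi _)).integrableOn measurableSet_Icc.compl ?_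
          filter_upwards [hN, hT _ (hu p.1), hT _ (hu p.2)] with t h1 h2 h3 ht
          have htT : T ≤ |t| := by
            by_contra! h'
            exact ht (abs_le.1 h'.le)
          have e1 := hW2' t ((u p.1).fn t) (by linarith [h2 htT])
          have e2 := hW2' t ((u p.2).fn t) (by linarith [h3 htT])
          rw [h1, h1]
          have e3 := (norm_sub_le (gradient (W t) ((u p.1).fn t))
            (gradient (W t) ((u p.2).fn t))).trans (add_le_add e1 e2)
          refine (pow_le_pow_left₀ (norm_nonneg _) e3 2).trans ?_
          nlinarith [sq_nonneg (ε * ‖(u p.1).fn t‖ - ε * ‖(u p.2).fn t‖)]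
      _ ≤ ∫ t, (2 * ε ^ 2 * ‖(u p.1).fn t‖ ^ 2 + 2 * ε ^ 2 * ‖(u p.2).fn t‖ ^ 2) :=
          setIntegral_le_integral ((hi _).add (hi _))
            (Eventually.of_forall fun t => by positivity)
      _ ≤ 4 * ε ^ 2 * (C * M) ^ 2 := by
          rw [integral_add (hi _) (hi _), integral_const_mul, integral_const_mul]
          have := add_le_add (hle p.1) (hle p.2)
          nlinarith [sq_nonneg ε]
  rw [cauchySeq_iff_tendsto_dist_atTop_0]
  have hsq : Tendsto (fun p : ℕ × ℕ => ‖nemytskii W (u p.1) - nemytskii W (u p.2)‖ ^ 2) atTop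
      (𝓝 0) := by
    rw [tendsto_order]
    refine ⟨fun a ha => Eventually.of_forall fun p => ha.trans_le (sq_nonneg _), fun a ha => ?_⟩
    obtain ⟨ε, hε, hεa⟩ : ∃ ε : ℝ, 0 < ε ∧ 4 * ε ^ 2 * (C * M) ^ 2 < a / 2 := by
      have hlim : Tendsto (fun ε : ℝ => 4 * ε ^ 2 * (C * M) ^ 2) (𝓝[>] 0) (𝓝 0) := by
        have : Continuous fun ε : ℝ => 4 * ε ^ 2 * (C * M) ^ 2 := by fun_prop
        simpa using (this.tendsto 0).mono_left (nhdsWithin_le_nhds (s := Set.Ioi 0))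
      obtain ⟨ε, h1, h2⟩ := ((hlim.eventually (gt_mem_nhds (half_pos ha))).and
        self_mem_nhdsWithin).exists
      exact ⟨ε, h2, h1⟩
    obtain ⟨T, hT⟩ := htail ε hε
    filter_upwards [(hlocal T).eventually (gt_mem_nhds (half_pos ha))] with p hp
    have hcongr : ∫ t, ‖(nemytskii W (u p.1) - nemytskii W (u p.2)) t‖ ^ 2 =
        ∫ t, ‖nemytskii W (u p.1) t - nemytskii W (u p.2) t‖ ^ 2 := by
      refine integral_congr_ae ?_
      filter_upwards [Lp.coeFn_sub (nemytskii W (u p.1)) (nemytskii W (u p.2))] with t ht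
      rw [ht, Pi.sub_apply]
    rw [norm_sq_L2, hcongr, ← integral_add_compl (measurableSet_Icc (a := -T) (b := T)) (hInt p)]
    linarith [hT p]
  have := hsq.sqrt
  simpa [Real.sqrt_sq (norm_nonneg _), dist_eq_norm] using this

/-- The `L^∞` embedding turns convergence in `X^α` into almost everywhere convergence. The images
are then Cauchy in `L²`, and an almost everywhere convergent subsequence identifies the limit. -/
theorem continuous_nemytskii (hα : 1 / 2 < α) (hα' : α < 1)
    (hW : ContDiff ℝ 1 fun p : ℝ × Vec n => W p.1 p.2) (hW2 : CondW2 W) :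
    Continuous (nemytskii W : XSpace α hL → L2 n) := by
  rw [continuous_iff_seqContinuous]
  intro u v huv
  obtain ⟨K, hK, hsup⟩ := XSpace.exists_ae_norm_le hα hα' hL
  obtain ⟨M, hM⟩ := huv.norm.bddAbove_range
  have hae : ∀ᵐ t, Tendsto (fun k => (u k).fn t) atTop (𝓝 (v.fn t)) := by
    filter_upwards [ae_all_iff.2 fun k => hsup (u k - v),
      ae_all_iff.2 fun k => Lp.coeFn_sub (u k).fn v.fn] with t h1 h2
    rw [tendsto_iff_norm_sub_tendsto_zero] at huv ⊢
    refine squeeze_zero (fun _ => norm_nonneg _) (fun k => ?_)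
      (by simpa only [mul_zero] using huv.const_mul K)
    have h3 := h1 k
    rwa [XSpace.fn_sub, h2 k, Pi.sub_apply] at h3
  have hC := cauchySeq_nemytskii hα hα' hW hW2 (fun k => hM ⟨k, rfl⟩)
    (hae.mono fun t ht => ⟨_, ht⟩)
  obtain ⟨f, hf⟩ := cauchySeq_tendsto_of_complete hC
  obtain ⟨φ, hφ, hfae⟩ := exists_subseq_ae_tendsto hf
  have : f = nemytskii W v := by
    refine Lp.ext ?_
    filter_upwards [hfae, hae, coeFn_nemytskii hα hα' hW hW2 v,
      ae_all_iff.2 fun k => coeFn_nemytskii hα hα' hW hW2 (u k)] with t h1 h2 h3 h4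
    refine tendsto_nhds_unique h1 ?_
    rw [h3]
    simp only [h4]
    exact (((continuous_gradient_potential hW).comp
      (Continuous.prodMk_right t)).tendsto _).comp (h2.comp hφ.tendsto_atTop)
  rw [← this]
  exact hf

end Nemytskii

/-! ### The energy functional: regularity, compactness, geometry -/

section Energy

variable {n : ℕ} {α : ℝ} {L : ℝ → Matrix (Fin n) (Fin n) ℝ} {hL : CondL L}
  {W : ℝ → Vec n → ℝ}

/-- Differentiation under the integral sign, dominated by `C (‖u‖ + ‖v‖) ‖v‖`. The larger of `‖u
t‖`, `‖v t‖` decides which of the two gradient bounds applies to `u t + s • v t`. -/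
theorem hasDerivAt_integral_potential_add_smul
    (hW : ContDiff ℝ 1 fun p : ℝ × Vec n => W p.1 p.2) {u v : L2 n} {C : ℝ} (hC : 0 < C)
    (hu : ∀ᵐ t, ∀ x, ‖x‖ ≤ 2 * ‖u t‖ → ‖gradient (W t) x‖ ≤ C * ‖x‖)
    (hv : ∀ᵐ t, ∀ x, ‖x‖ ≤ 2 * ‖v t‖ → ‖gradient (W t) x‖ ≤ C * ‖x‖)
    (hInt : Integrable fun t => W t (u t)) :
    HasDerivAt (fun s : ℝ => ∫ t, W t (u t + s • v t))
      (∫ t, inner ℝ (gradient (W t) (u t)) (v t)) 0 := by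
  have hmu := Lp.aestronglyMeasurable u
  have hmv := Lp.aestronglyMeasurable v
  have hbound : Integrable fun t => C * ((‖u t‖ + ‖v t‖) * ‖v t‖) :=
    (((Lp.memLp u).norm.add (Lp.memLp v).norm).integrable_mul (Lp.memLp v).norm).const_mul C
  have hdom : ∀ᵐ t, ∀ s ∈ Metric.ball (0 : ℝ) 1,
      ‖(inner ℝ (gradient (W t) (u t + s • v t)) (v t) : ℝ)‖ ≤
        C * ((‖u t‖ + ‖v t‖) * ‖v t‖) := by
    filter_upwards [hu, hv] with t h1 h2 s hs
    have hs1 : |s| < 1 := by simpa using hs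
    have hx : ‖u t + s • v t‖ ≤ ‖u t‖ + ‖v t‖ := by
      refine (norm_add_le _ _).trans (add_le_add_right ?_ _)
      rw [norm_smul, Real.norm_eq_abs]
      exact mul_le_of_le_one_left (norm_nonneg _) hs1.le
    have hg : ‖gradient (W t) (u t + s • v t)‖ ≤ C * ‖u t + s • v t‖ := by
      rcases le_total ‖u t‖ ‖v t‖ with h | h
      · exact h2 _ (by linarith)
      · exact h1 _ (by linarith)
    refine (norm_inner_le_norm _ _).trans ?_
    rw [← mul_assoc]
    refine mul_le_mul_of_nonneg_right (hg.trans ?_) (norm_nonneg _)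
    exact mul_le_mul_of_nonneg_left hx hC.le
  have hmeas : ∀ s : ℝ, AEStronglyMeasurable (fun t => W t (u t + s • v t)) volume := fun s =>
    hW.continuous.comp_aestronglyMeasurable
      (aestronglyMeasurable_id.prodMk (hmu.add (hmv.const_smul s)))
  have hmeas' : AEStronglyMeasurable
      (fun t => (inner ℝ (gradient (W t) (u t + (0 : ℝ) • v t)) (v t) : ℝ)) volume :=
    (aestronglyMeasurable_gradient hW (hmu.add (hmv.const_smul (0 : ℝ)))).inner hmv
  have hmain := hasDerivAt_integral_of_dominated_loc_of_deriv_le (μ := volume)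
    (F := fun (s : ℝ) t => W t (u t + s • v t))
    (F' := fun (s : ℝ) t => inner ℝ (gradient (W t) (u t + s • v t)) (v t))
    (Metric.ball_mem_nhds (0 : ℝ) one_pos) (Eventually.of_forall hmeas)
    (by simpa only [zero_smul, add_zero] using hInt) hmeas' hdom hbound
    (Eventually.of_forall fun t s _ => hasDerivAt_potential_line hW t _ _ s)
  simpa only [zero_smul, add_zero] using hmain.2

theorem hasDerivAt_integral_potential_line (hn : 1 ≤ n) (hα : 1 / 2 < α) (hα' : α < 1)
    (hW1 : CondW1 W) (hW2 : CondW2 W) (u v : XSpace α hL) :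
    HasDerivAt (fun s : ℝ => ∫ t, W t ((u + s • v).fn t))
      (inner ℝ (nemytskii W u) v.fn) 0 := by
  have hW := hW1.1
  obtain ⟨C, hC, hgrad⟩ := exists_gradient_bound hα hα' hL hW hW2 (max ‖u‖ ‖v‖)
  have hmain := hasDerivAt_integral_potential_add_smul hW hC (hgrad u (le_max_left _ _))
    (hgrad v (le_max_right _ _)) (integrable_potential hn hα hα' hW1 hW2 u)
  have hfun : (fun s : ℝ => ∫ t, W t ((u + s • v).fn t)) =
      fun s : ℝ => ∫ t, W t (u.fn t + s • v.fn t) := by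
    ext1 s
    refine integral_congr_ae ?_
    filter_upwards [Lp.coeFn_add u.fn (s • v.fn), Lp.coeFn_smul s v.fn] with t h1 h2
    rw [XSpace.fn_add, XSpace.fn_smul, h1, Pi.add_apply, h2, Pi.smul_apply]
  have hval : inner ℝ (nemytskii W u) v.fn =
      ∫ t, inner ℝ (gradient (W t) (u.fn t)) (v.fn t) := by
    rw [L2.inner_def]
    refine integral_congr_ae ?_
    filter_upwards [coeFn_nemytskii hα hα' hW hW2 u] with t ht
    rw [ht]
  rw [hfun, hval]
  exact hmain

/-- The gradient of the energy functional in the Hilbert space `X^α`. -/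
def energyGrad (W : ℝ → Vec n → ℝ) (u : XSpace α hL) : XSpace α hL :=
  u - ContinuousLinearMap.adjoint XSpace.fnL (nemytskii W u)

theorem inner_energyGrad (u v : XSpace α hL) :
    inner ℝ (energyGrad W u) v = inner ℝ u v - inner ℝ (nemytskii W u) v.fn := by
  rw [energyGrad, inner_sub_left, ContinuousLinearMap.adjoint_inner_left, XSpace.fnL_apply]

theorem continuous_energyGrad (hα : 1 / 2 < α) (hα' : α < 1)
    (hW : ContDiff ℝ 1 fun p : ℝ × Vec n => W p.1 p.2) (hW2 : CondW2 W) :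
    Continuous (energyGrad W : XSpace α hL → XSpace α hL) :=
  continuous_id.sub ((ContinuousLinearMap.continuous _).comp
    (continuous_nemytskii hα hα' hW hW2))

theorem energy_eq (u : XSpace α hL) :
    energy hL W u = 1 / 2 * ‖u‖ ^ 2 - ∫ t, W t (u.fn t) := by
  rw [energy, ← real_inner_self_eq_norm_sq u, XSpace.inner_eq_form, XSpace.form]
  simp only [real_inner_self_eq_norm_sq]

theorem hasFDerivAt_energy (hn : 1 ≤ n) (hα : 1 / 2 < α) (hα' : α < 1)
    (hW1 : CondW1 W) (hW2 : CondW2 W) (u : XSpace α hL) :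
    HasFDerivAt (energy hL W) (innerSL ℝ (energyGrad W u)) u := by
  have h1 : HasFDerivAt (fun u : XSpace α hL => ∫ t, W t (u.fn t))
      ((innerSL ℝ (nemytskii W u)).comp XSpace.fnL) u := by
    refine hasFDerivAt_of_hasDerivAt_line
      (f' := fun u : XSpace α hL => (innerSL ℝ (nemytskii W u)).comp XSpace.fnL)
      (fun u v => hasDerivAt_integral_potential_line hn hα hα' hW1 hW2 u v) ?_ u
    exact ((innerSL ℝ).continuous.comp (continuous_nemytskii hα hα' hW1.1 hW2)).clm_comp
      continuous_const
  have h2 := ((hasStrictFDerivAt_norm_sq u).hasFDerivAt.const_mul (1 / 2)).sub h1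
  have h3 : innerSL ℝ (energyGrad W u) = (1 / 2 : ℝ) • (2 • innerSL ℝ u) -
      (innerSL ℝ (nemytskii W u)).comp XSpace.fnL := by
    ext v
    simp [inner_energyGrad, XSpace.fnL_apply]
  rw [h3]
  exact h2.congr_of_eventuallyEq (Eventually.of_forall energy_eq)

theorem contDiff_energy (hn : 1 ≤ n) (hα : 1 / 2 < α) (hα' : α < 1)
    (hW1 : CondW1 W) (hW2 : CondW2 W) : ContDiff ℝ 1 (energy (α := α) hL W) :=
  contDiff_one_iff_hasFDerivAt.2 ⟨_, (innerSL ℝ).continuous.comp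
    (continuous_energyGrad hα hα' hW1.1 hW2), hasFDerivAt_energy hn hα hα' hW1 hW2⟩

theorem energy_zero (hn : 1 ≤ n) (hW1 : CondW1 W) : energy (α := α) hL W 0 = 0 := by
  obtain ⟨μ, -, h⟩ := hW1.exists_superquadratic hn
  have : ∫ t, W t ((0 : XSpace α hL).fn t) = 0 := by
    refine integral_eq_zero_of_ae ?_
    filter_upwards [Lp.coeFn_zero (Vec n) 2 (volume : Measure ℝ)] with t ht
    have h0 : (0 : XSpace α hL).fn t = 0 := ht
    rw [h0, (h t).1, Pi.zero_apply]
  rw [energy_eq, this]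
  simp

/-- The Palais–Smale condition. -/
theorem exists_subseq_tendsto_of_palais_smale (hn : 1 ≤ n) (hα : 1 / 2 < α) (hα' : α < 1)
    (hW1 : CondW1 W) (hW2 : CondW2 W) {u : ℕ → XSpace α hL} {c : ℝ}
    (hJ : Tendsto (fun k => energy hL W (u k)) atTop (𝓝 c))
    (hg : Tendsto (fun k => energyGrad W (u k)) atTop (𝓝 0)) :
    ∃ (x : XSpace α hL) (φ : ℕ → ℕ), StrictMono φ ∧
      Tendsto (fun k => u (φ k)) atTop (𝓝 x) := by
  obtain ⟨μ, hμ, hAR⟩ := hW1.exists_superquadratic hn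
  -- In `μ I(v) - ⟨I'(v), v⟩` the potential terms have a favourable sign by (W₁), leaving a positive
  -- multiple of `‖v‖²`.
  have hkey : ∀ v : XSpace α hL, (μ / 2 - 1) * ‖v‖ ^ 2 ≤
      μ * energy hL W v - inner ℝ (energyGrad W v) v := by
    intro v
    have h1 : μ * ∫ t, W t (v.fn t) ≤ inner ℝ (nemytskii W v) v.fn := by
      rw [L2.inner_def, ← integral_const_mul]
      refine integral_mono_ae ((integrable_potential hn hα hα' hW1 hW2 v).const_mul μ)
        (L2.integrable_inner (𝕜 := ℝ) _ _) ?_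
      filter_upwards [coeFn_nemytskii hα hα' hW1.1 hW2 v] with t ht
      rw [ht, real_inner_comm]
      exact ((hAR t).2 _).2
    rw [energy_eq, inner_energyGrad, real_inner_self_eq_norm_sq]
    linarith
  obtain ⟨A, hA⟩ := hJ.bddAbove_range
  obtain ⟨G, hG⟩ := hg.norm.bddAbove_range
  have hμ2 : 0 < μ / 2 - 1 := by linarith
  set M := max 1 ((μ * |A| + G) / (μ / 2 - 1)) with hM
  have hbdd : ∀ k, ‖u k‖ ≤ M := by
    intro k
    rcases le_total ‖u k‖ 1 with h | h
    · exact h.trans (le_max_left _ _)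
    refine le_trans ?_ (le_max_right _ _)
    rw [le_div_iff₀ hμ2]
    have h1 := hkey (u k)
    have h2 : energy hL W (u k) ≤ |A| := (hA ⟨k, rfl⟩).trans (le_abs_self A)
    have h3 : ‖energyGrad W (u k)‖ ≤ G := hG ⟨k, rfl⟩
    have h4 := (abs_le.1 (abs_real_inner_le_norm (energyGrad W (u k)) (u k))).1
    have h5 := mul_le_mul_of_nonneg_right h3 (norm_nonneg (u k))
    have h6 : μ * energy hL W (u k) ≤ μ * |A| * ‖u k‖ :=
      (mul_le_mul_of_nonneg_left h2 (by linarith)).trans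
        (le_mul_of_one_le_right (mul_nonneg (by linarith) (abs_nonneg _)) h)
    have h7 : (‖u k‖ * (μ / 2 - 1)) * ‖u k‖ ≤ (μ * |A| + G) * ‖u k‖ := by
      nlinarith
    exact le_of_mul_le_mul_right h7 (by linarith)
  obtain ⟨φ, hφ, hae⟩ := XSpace.exists_subseq_ae_tendsto_of_bounded hα hα' hbdd
  obtain ⟨f, hf⟩ := cauchySeq_tendsto_of_complete
    (cauchySeq_nemytskii hα hα' hW1.1 hW2 (fun k => hbdd (φ k)) hae)
  -- `u = I'(u) + fnL* (∇W(·, u))`: the first term tends to `0`, and the second converges along the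
  -- subsequence.
  refine ⟨0 + ContinuousLinearMap.adjoint XSpace.fnL f, φ, hφ, ?_⟩
  refine ((hg.comp hφ.tendsto_atTop).add (((ContinuousLinearMap.adjoint
    (XSpace.fnL (α := α) (hL := hL))).continuous.tendsto f).comp hf)).congr fun k => ?_
  simp [energyGrad]

theorem exists_sphere (hn : 1 ≤ n) (hα : 1 / 2 < α) (hα' : α < 1) (hL : CondL L)
    (hW1 : CondW1 W) (hW2 : CondW2 W) :
    ∃ ρ β : ℝ, 0 < ρ ∧ 0 < β ∧ ∀ w : XSpace α hL, ‖w‖ = ρ → β ≤ energy hL W w := by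
  obtain ⟨C, hC, hfn⟩ := XSpace.exists_norm_fn_le α hL
  obtain ⟨K, hK, hsup⟩ := XSpace.exists_ae_norm_le hα hα' hL
  obtain ⟨δ, hδ, hsmall⟩ := hW2 (1 / (4 * C ^ 2)) (by positivity)
  -- This radius gives `‖w t‖ ≤ δ / 2` almost everywhere, so (W₂) applies; `1 / (4 C²)` then bounds
  -- `∫ W` by `‖w‖² / 4`, leaving `‖w‖² / 4` of the quadratic part.
  refine ⟨δ / (2 * K), (δ / (2 * K)) ^ 2 / 4, by positivity, by positivity, fun w hw => ?_⟩
  have h1 : ∫ t, W t (w.fn t) ≤ 1 / (4 * C ^ 2) * ‖w.fn‖ ^ 2 := by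
    rw [norm_sq_L2, ← integral_const_mul]
    refine integral_mono_ae (integrable_potential hn hα hα' hW1 hW2 w)
      ((integrable_norm_sq _).const_mul _) ?_
    filter_upwards [hsup w] with t ht
    have hlt : ‖w.fn t‖ < δ := by
      refine lt_of_le_of_lt ht ?_
      rw [hw, show K * (δ / (2 * K)) = δ / 2 by field_simp]
      exact half_lt_self hδ
    refine (le_abs_self _).trans ((potential_le hn hW1 t _).trans ?_)
    have := mul_le_mul_of_nonneg_left (hsmall t _ hlt) (norm_nonneg (w.fn t))
    refine this.trans (le_of_eq ?_)
    ring
  have h2 : 1 / (4 * C ^ 2) * ‖w.fn‖ ^ 2 ≤ 1 / 4 * ‖w‖ ^ 2 := by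
    have h3 := pow_le_pow_left₀ (norm_nonneg _) (hfn w) 2
    have h4 := mul_le_mul_of_nonneg_left h3 (show 0 ≤ 1 / (4 * C ^ 2) by positivity)
    refine h4.trans (le_of_eq ?_)
    field_simp
  rw [energy_eq]
  rw [← hw]
  linarith

theorem XSpace.exists_fn_ne_zero (hn : 1 ≤ n) (hα : 1 / 2 < α) (hα' : α < 1) (hL : CondL L) :
    ∃ u : XSpace α hL, u.fn ≠ 0 := by
  obtain ⟨p, hp, hne⟩ := exists_ne_zero_mem_testGraph (α := α) hn hα hα'
  have hmem : p ∈ xSubmodule α hL := by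
    refine ⟨Submodule.le_topologicalClosure _ (Submodule.subset_span hp), ?_⟩
    obtain ⟨φ, hφ, hc, h1, -⟩ := hp
    have hcont : Continuous fun t => inner ℝ (matVec (L t) (φ t)) (φ t) := by
      have hL' := fun i j => hL.continuous.matrix_elem i j
      have hφ' := hφ.continuous
      simp only [inner_matVec]
      fun_prop
    have hcs : HasCompactSupport fun t => inner ℝ (matVec (L t) (φ t)) (φ t) :=
      hc.mono' fun t ht => subset_closure fun h0 => ht (by simp [h0])
    refine (hcont.integrable_of_hasCompactSupport hcs).congr ?_
    filter_upwards [h1] with t ht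
    rw [ht]
  exact ⟨⟨p, hmem⟩, hne⟩

theorem exists_energy_nonpos (hn : 1 ≤ n) (hα : 1 / 2 < α) (hα' : α < 1) (hL : CondL L)
    (hW1 : CondW1 W) (hW2 : CondW2 W) (ρ : ℝ) :
    ∃ e : XSpace α hL, ρ < ‖e‖ ∧ energy hL W e ≤ 0 := by
  obtain ⟨u, hu⟩ := XSpace.exists_fn_ne_zero hn hα hα' hL
  obtain ⟨μ, hμ, hAR⟩ := hW1.exists_superquadratic hn
  have hpos : ∀ t x, x ≠ 0 → 0 < W t x := fun t x hx => by
    obtain ⟨-, ν, hν, h⟩ := hW1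
    exact pos_of_mul_pos_right (h t x hx).1 (by linarith)
  have hInt := integrable_potential hn hα hα' hW1 hW2 u
  set B := ∫ t, W t (u.fn t) with hB
  have hB0 : 0 < B := by
    refine lt_of_le_of_ne (integral_nonneg fun t => ((hAR t).2 _).1) fun h0 => hu ?_
    have h1 := (integral_eq_zero_iff_of_nonneg (fun t => ((hAR t).2 _).1) hInt).1 h0.symm
    refine Lp.eq_zero_iff_ae_eq_zero.2 (h1.mono fun t ht => ?_)
    by_contra hne
    exact (hpos t _ hne).ne' ht
  have hu0 : 0 < ‖u‖ := by
    refine norm_pos_iff.2 fun h0 => hu ?_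
    rw [h0]
    rfl
  have hlim : Tendsto (fun s : ℝ => s ^ (μ - 2)) atTop atTop :=
    tendsto_rpow_atTop (by linarith)
  -- `I(s u) ≤ s² ‖u‖² / 2 - s^μ B`, which is nonpositive once `s^(μ-2) ≥ ‖u‖² / B`.
  obtain ⟨s, ⟨hs1, hs2⟩, hs3⟩ := (((eventually_ge_atTop (1 : ℝ)).and
    (eventually_gt_atTop (ρ / ‖u‖))).and
    (hlim.eventually (eventually_ge_atTop (‖u‖ ^ 2 / B)))).exists
  have hs0 : 0 < s := by linarith
  refine ⟨s • u, ?_, ?_⟩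
  · rw [norm_smul, Real.norm_of_nonneg hs0.le]
    exact (div_lt_iff₀ hu0).1 hs2
  · have h1 : s ^ μ * B ≤ ∫ t, W t ((s • u).fn t) := by
      rw [hB, ← integral_const_mul]
      refine integral_mono_ae (hInt.const_mul _)
        (integrable_potential hn hα hα' hW1 hW2 (s • u)) ?_
      filter_upwards [Lp.coeFn_smul s u.fn] with t ht
      rw [XSpace.fn_smul, ht]
      exact rpow_mul_potential_le hW1.1 t (fun x => ((hAR t).2 x).2) _ hs1
    have h2 : s ^ μ = s ^ (μ - 2) * s ^ 2 := by
      rw [← Real.rpow_two, ← Real.rpow_add hs0, sub_add_cancel]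
    have h3 : ‖u‖ ^ 2 ≤ s ^ (μ - 2) * B := (div_le_iff₀ hB0).1 hs3
    have h4 := mul_le_mul_of_nonneg_left h3 (sq_nonneg s)
    rw [energy_eq, norm_smul, Real.norm_of_nonneg hs0.le, mul_pow]
    rw [h2] at h1
    nlinarith [mul_nonneg (sq_nonneg s) (sq_nonneg ‖u‖)]

end Energy

end FracHam

end

/-! ### The existence theorem -/

theorem theorem1p1 {n : ℕ} (hn : 1 ≤ n) (α : ℝ) (hα : 1 / 2 < α) (hα' : α < 1)
    (L : ℝ → Matrix (Fin n) (Fin n) ℝ) (hL : FracHam.CondL L)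
    (W : ℝ → FracHam.Vec n → ℝ) (hW1 : FracHam.CondW1 W) (hW2 : FracHam.CondW2 W) :
    (∀ u : FracHam.XSpace α hL, MeasureTheory.Integrable (fun t => W t (u.fn t))) ∧
    ContDiff ℝ 1 (FracHam.energy (α := α) hL W) ∧
    ∃ u : FracHam.XSpace α hL, u.fn ≠ 0 ∧ FracHam.IsWeakSolution W u ∧
      FracHam.IsMountainPassPoint (FracHam.energy hL W) u := by
  refine ⟨FracHam.integrable_potential hn hα hα' hW1 hW2,
    FracHam.contDiff_energy hn hα hα' hW1 hW2, ?_⟩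
  have hderiv := FracHam.hasFDerivAt_energy (α := α) (hL := hL) hn hα hα' hW1 hW2
  have hJ0 : FracHam.energy (α := α) hL W 0 = 0 := FracHam.energy_zero hn hW1
  obtain ⟨ρ, β, hρ, hβ, hsphere⟩ := FracHam.exists_sphere (α := α) hn hα hα' hL hW1 hW2
  obtain ⟨e, he, hJe⟩ := FracHam.exists_energy_nonpos (α := α) hn hα hα' hL hW1 hW2 ρ
  obtain ⟨u, hgu, hβu, hglb⟩ := FracHam.mountain_pass hderiv
    (FracHam.continuous_energyGrad hα hα' hW1.1 hW2)
    (fun _ _ => FracHam.exists_subseq_tendsto_of_palais_smale hn hα hα' hW1 hW2)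
    hρ hβ hsphere he hJ0 hJe
  have hcrit : ∀ v, inner ℝ u v = inner ℝ (FracHam.nemytskii W u) v.fn := fun v => by
    have h := FracHam.inner_energyGrad (W := W) u v
    rw [hgu, inner_zero_left] at h
    linarith
  refine ⟨u, fun h0 => ?_, fun v => ⟨(FracHam.XSpace.integrable_D u v).add
    (FracHam.XSpace.integrable_L u v), ?_, ?_⟩, ?_, hJ0, ρ, β, e, hρ, hβ, hsphere, he, hJe, hβu,
    hglb⟩
  -- If the function part vanished, the critical point equation tested with `u` would give `u = 0`,
  -- against `I(u) ≥ β > 0 = I(0)`.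
  · have h := hcrit u
    rw [h0, inner_zero_right, inner_self_eq_zero] at h
    rw [h, hJ0] at hβu
    exact hβ.not_ge hβu
  · refine (MeasureTheory.L2.integrable_inner (𝕜 := ℝ) (FracHam.nemytskii W u) v.fn).congr ?_
    filter_upwards [FracHam.coeFn_nemytskii hα hα' hW1.1 hW2 u] with t ht
    rw [ht]
  · refine (hcrit v).trans ?_
    rw [MeasureTheory.L2.inner_def]
    refine MeasureTheory.integral_congr_ae ?_
    filter_upwards [FracHam.coeFn_nemytskii hα hα' hW1.1 hW2 u] with t ht
    rw [ht]
  · have h := hderiv u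
    rwa [hgu, map_zero] at h
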